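/- **Coverage under DP-SGD training.** *Setting.* Let $Z_1,Z_2,\dots$ be i.i.d. data points $Z_i=(X_i,Y_i)$, let $\alpha\in(0,1)$, let $\Theta\subset\mathbb R^d$ be nonempty, closed and convex, $\ell(\theta;z)$ a loss and $s(z;\theta)$ a score. For every sample size $n$ fix a step size $\eta\ge 0$, a clipping norm $C>0$, a noise level $\sigma\ge 0$, a subsampling rate $q\in[0,1]$, a number of iterations $T$ and a starting point $\theta^{(0)}\in\Theta$; all of these may depend on $n$. *Training.* Projected DP-SGD on a dataset $z_1,\dots,z_m$ draws, in iteration $t$, a minibatch $B_t$ containing each index independently with probability $q$, and a vector $\xi_t\sim N(0,I_d)$. If $B_t=\emptyset$ it sets $\theta^{(t+1)}=\theta^{(t)}$, and otherwise $$\theta^{(t+1)}=\Pi_\Theta\Bigl(\theta^{(t)}-\frac{\eta}{|B_t|}\Bigl(\sum_{i\in B_t}\mathrm{clip}_C\bigl(\nabla_\theta\ell(\theta^{(t)};z_i)\bigr)+\sigma\,\xi_t\Bigr)\Bigr),\qquad \mathrm{clip}_C(g)=g\min\{1,C/\|g\|_2\}.$$ Let $\theta_n$ and $\theta_{n+1}$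 be the outputs after $T$ iterations on $Z_1,\dots,Z_n$ and on $Z_1,\dots,Z_{n+1}$, run with the same hyperparameters (those of sample size $n$) and coupled by sharing the vectors $\xi_t$ and the inclusion indicators of the first $n$ points. Put $S_i^{(n)}=s(Z_i;\theta_n)$ and $S_i^{(n+1)}=s(Z_i;\theta_{n+1})$ for $1\le i\le n+1$. *Calibration.* Let $r=\lceil(1-\alpha)(n+1)\rceil$. Given a buffer $m_n$, a number of steps $N$, a noise scale $\sigma_Q>0$, $\beta_n\in(0,1)$ and a range $[a,b]$ with $b\ge\max_{i\le n}S_i^{(n)}$ almost surely (the endpoints may depend on $S^{(n)}_1,\dots,S^{(n)}_n$), the search puts $\tau=\sigma_Q\Phi^{-1}(1-\beta_n/N)-1$, $r'=r+m_n+\tau$, $\mathrm{left}=a$, $\mathrm{right}=b$, and repeats $N$ times: with $\mathrm{mid}=(\mathrm{left}+\mathrm{right})/2$ and independent noise $W_k\sim N(0,\sigma_Q^2)$, if $\#\{i\le n:S_i^{(n)}\le\mathrm{mid}\}+W_k\ge r'$ set $\mathrm{right}=\mathrm{mid}$, otherwise set $\mathrm{left}=\mathrm{mid}$. Its output $\hat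 q$ is the final value of $\mathrm{right}$. Data, minibatches, training noise and search noise are independent. *Assumptions.* 1. For every $z$, $\nabla_\theta\ell(\cdot;z)$ exists and is $L_\ell$-Lipschitz on $\Theta$, with $L_\ell>0$. 2. $|s(z;\theta)-s(z;\theta')|\le L\|\theta-\theta'\|_2$ for all $z$ and $\theta,\theta'\in\Theta$, with $L\ge0$. 3. For every $n$ and $i\ne j$, $\mathbb P(S_i^{(n+1)}=S_j^{(n+1)})=0$. 4. There are constants $\bar f<\infty$ and $\rho>0$, independent of $n$, such that for all $n$, all $\varepsilon\in(0,\rho]$ and all $i\le n+1$, $\mathbb P(q_*<S_i^{(n+1)}\le q_*+\varepsilon)\le\bar f\varepsilon$ and $\mathbb P(q_*-\varepsilon\le S_i^{(n+1)}<q_*)\le\bar f\varepsilon$, where $q_*$ is the $r$-th order statistic of $S_1^{(n+1)},\dots,S_{n+1}^{(n+1)}$. 5. As $n\to\infty$: $\eta=O(1/n)$, $T=O(n)$, $2C+\sigma\sqrt d=O(1)$ and $\beta_n=O(1/n)$. Let $$E_n=\frac{1-(1-q)^{n+1}}{(n+1)L_\ell}\,(2C+\sigma\sqrt d)\,\bigl(e^{\eta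 L_\ell T}-1\bigr),$$ let $u_n,\delta_n>0$ satisfy $u_n=\Theta(E_n^{2/3})$ and $\delta_n=\Theta(E_n^{1/3})$, and run the search with $m_n=\lceil n\bar fLu_n/\delta_n\rceil$. *Conclusions.* (a) For every $n$ with $E_n\le u_n\delta_n$ (for instance if $u_n=E_n^{2/3}$ and $\delta_n=E_n^{1/3}$), model stability holds: $\mathbb P(\|\theta_{n+1}-\theta_n\|_2>u_n)\le\delta_n$. (b) $m_n=O(n^{2/3})$. (c) For every $n$ at which model stability holds with $(u_n,\delta_n)$, $Lu_n\le\rho$ and $r+m_n\le n$, $$\mathbb P\bigl(S_{n+1}^{(n)}\le\hat q\bigr)\ \ge\ (1-\beta_n)\Bigl(1-\alpha-2\bar fLu_n-3\delta_n-\frac1{n+1}\Bigr).$$ (d) The conditions $Lu_n\le\rho$ and $r+m_n\le n$ hold for all sufficiently large $n$. (e) The right-hand side in (c) tends to $1-\alpha$ as $n\to\infty$. -/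

import Mathlib

open MeasureTheory ProbabilityTheory Filter Asymptotics Topology

noncomputable section

namespace DPSCP

/-- The parameter space `ℝ^d` with its Euclidean norm. -/
abbrev E (d : ℕ) : Type := EuclideanSpace ℝ (Fin d)

/-! ### Projected DP-SGD -/

/-- Euclidean projection onto `K`: a point of `K` nearest to `x`
(existing and unique when `K` is nonempty, closed and convex). -/
def proj {d : ℕ} (K : Set (E d)) (x : E d) : E d :=
  Classical.epsilon fun y => y ∈ K ∧ ∀ w ∈ K, ‖x - y‖ ≤ ‖x - w‖

/-- Norm clipping `g ↦ g · min {1, C / ‖g‖}`. -/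
def clip {d : ℕ} (C : ℝ) (g : E d) : E d := min 1 (C / ‖g‖) • g

/-- Hyperparameters of a DP-SGD run. -/
structure SGDParams (d : ℕ) where
  /-- step size -/
  η : ℝ
  /-- clipping norm -/
  C : ℝ
  /-- standard deviation, per coordinate, of the Gaussian noise added to the sum of the
  clipped gradients -/
  σ : ℝ
  /-- Poisson subsampling rate -/
  q : unitInterval
  /-- number of iterations -/
  T : ℕ
  /-- initial point -/
  θ₀ : E d

/-- One update of projected DP-SGD on the dataset `z`, from the current iterate `θ`, with
inclusion mask `b` and Gaussian vector `ξ`. The update is skipped if the minibatch is empty. -/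
def sgdStep {𝒵 : Type*} {d m : ℕ} (K : Set (E d)) (loss : E d → 𝒵 → ℝ) (h : SGDParams d)
    (z : Fin m → 𝒵) (b : Fin m → Bool) (ξ θ : E d) : E d :=
  let B : Finset (Fin m) := Finset.univ.filter fun i => b i = true
  if B = ∅ then θ
  else proj K (θ - h.η • ((B.card : ℝ)⁻¹ •
    (∑ i ∈ B, clip h.C (gradient (fun θ' => loss θ' (z i)) θ) + h.σ • ξ)))

/-- The iterate `θ^{(t)}` of projected DP-SGD on the dataset `z`, with masks `b t` and Gaussian
vectors `ξ t`. -/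
def sgdIter {𝒵 : Type*} {d m : ℕ} (K : Set (E d)) (loss : E d → 𝒵 → ℝ) (h : SGDParams d)
    (z : Fin m → 𝒵) (b : ℕ → Fin m → Bool) (ξ : ℕ → E d) : ℕ → E d
  | 0 => h.θ₀
  | t + 1 => sgdStep K loss h z (b t) (ξ t) (sgdIter K loss h z b ξ t)

/-! ### The probability space: data, training randomness, calibration randomness -/

/-- An outcome: the data `Z_1, …, Z_{n+1}`, the inclusion masks, the Gaussian vectors of the
training, and the Gaussian noise of the quantile search. -/
abbrev Sample (𝒵 : Type*) (d n : ℕ) : Type _ :=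
  ((Fin (n + 1) → 𝒵) × (ℕ → Fin (n + 1) → Bool)) × ((ℕ → E d) × (ℕ → ℝ))

/-- Everything is independent: data points i.i.d. with law `P`, inclusion indicators
i.i.d. Bernoulli(`q`), training noise i.i.d. `N(0, I_d)`, search noise i.i.d. `N(0, 1)`. -/
def sampleMeasure {𝒵 : Type*} [MeasurableSpace 𝒵] (P : Measure 𝒵) (d n : ℕ) (q : unitInterval) :
    Measure (Sample 𝒵 d n) :=
  ((Measure.pi fun _ => P).prod
    (Measure.infinitePi fun _ : ℕ => Measure.pi fun _ => bernoulliMeasure true false q)).prod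
  ((Measure.infinitePi fun _ : ℕ => stdGaussian (E d)).prod
    (Measure.infinitePi fun _ : ℕ => gaussianReal 0 1))

/-- `θ_n`: the model trained on the first `n` data points. -/
def thetaActual {𝒵 : Type*} {d n : ℕ} (K : Set (E d)) (loss : E d → 𝒵 → ℝ) (h : SGDParams d)
    (ω : Sample 𝒵 d n) : E d :=
  sgdIter K loss h (fun i : Fin n => ω.1.1 i.castSucc) (fun t i => ω.1.2 t i.castSucc) ω.2.1 h.T

/-- `θ_{n+1}`: the model trained on all `n + 1` data points, coupled with `θ_n` by using the same
Gaussian vectors and the same masks on the first `n` points (synchronized coupling). -/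
def thetaIdeal {𝒵 : Type*} {d n : ℕ} (K : Set (E d)) (loss : E d → 𝒵 → ℝ) (h : SGDParams d)
    (ω : Sample 𝒵 d n) : E d :=
  sgdIter K loss h ω.1.1 ω.1.2 ω.2.1 h.T

/-- Actual scores `S_i^{(n)} = s(Z_i; θ_n)`; the test point has index `Fin.last n`. -/
def actualScore {𝒵 : Type*} {d n : ℕ} (K : Set (E d)) (loss : E d → 𝒵 → ℝ) (s : 𝒵 → E d → ℝ)
    (h : SGDParams d) (i : Fin (n + 1)) (ω : Sample 𝒵 d n) : ℝ :=
  s (ω.1.1 i) (thetaActual K loss h ω)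

/-- Ideal scores `S_i^{(n+1)} = s(Z_i; θ_{n+1})`. -/
def idealScore {𝒵 : Type*} {d n : ℕ} (K : Set (E d)) (loss : E d → 𝒵 → ℝ) (s : 𝒵 → E d → ℝ)
    (h : SGDParams d) (i : Fin (n + 1)) (ω : Sample 𝒵 d n) : ℝ :=
  s (ω.1.1 i) (thetaIdeal K loss h ω)

/-! ### Ranks, order statistics, and the buffered noisy binary search -/

/-- The count `C(t) = #{i : S_i ≤ t}`. -/
def count {m : ℕ} (S : Fin m → ℝ) (t : ℝ) : ℕ := (Finset.univ.filter fun i => S i ≤ t).card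

/-- The `k`-th order statistic (for `1 ≤ k ≤ m`): the least `t` with `k ≤ C(t)`. -/
def orderStat {m : ℕ} (S : Fin m → ℝ) (k : ℕ) : ℝ := sInf {t | k ≤ count S t}

/-- The target rank `r = ⌈(1 - α)(n + 1)⌉`. -/
def targetRank (α : ℝ) (n : ℕ) : ℕ := ⌈(1 - α) * ((n : ℝ) + 1)⌉₊

/-- The quantile function `Φ⁻¹` of the standard normal distribution. -/
def normalQuantile (p : ℝ) : ℝ := sInf {x | p ≤ cdf (gaussianReal 0 1) x}

/-- The bracket `(left, right)` after `k` steps of the noisy binary search with threshold `r'`. The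
noisy count at step `k + 1` is `C(mid) + σ ζ_k`. -/
def searchBracket {m : ℕ} (S : Fin m → ℝ) (a b r' σ : ℝ) (ζ : ℕ → ℝ) : ℕ → ℝ × ℝ
  | 0 => (a, b)
  | k + 1 =>
    let p := searchBracket S a b r' σ ζ k
    let mid := (p.1 + p.2) / 2
    if r' ≤ (count S mid : ℝ) + σ * ζ k then (p.1, mid) else (mid, p.2)

/-- Output (the final right endpoint) of the buffered right-endpoint binary search on the scores
`S`, with range `[a, b]`, miscoverage `α`, buffer `buf`, `N` steps, noise scale `σ` and failure
probability `β`. -/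
def dpQuantile {n : ℕ} (S : Fin n → ℝ) (a b α : ℝ) (buf N : ℕ) (σ β : ℝ) (ζ : ℕ → ℝ) : ℝ :=
  let τ : ℝ := σ * normalQuantile (1 - β / N) - 1
  (searchBracket S a b ((targetRank α n : ℝ) + buf + τ) σ ζ N).2

/-- The threshold `q̂` of the procedure: the search is run on `S_1^{(n)}, …, S_n^{(n)}`. The end
points `a`, `b` of the search range may depend on these scores. -/
def qHat {𝒵 : Type*} {d n : ℕ} (K : Set (E d)) (loss : E d → 𝒵 → ℝ) (s : 𝒵 → E d → ℝ)
    (h : SGDParams d) (a b : (Fin n → ℝ) → ℝ) (α : ℝ) (buf N : ℕ) (σ β : ℝ)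
    (ω : Sample 𝒵 d n) : ℝ :=
  let S : Fin n → ℝ := fun i => actualScore K loss s h i.castSucc ω
  dpQuantile S (a S) (b S) α buf N σ β ω.2.2

/-- `q_*`: the `r`-th order statistic of the `n + 1` ideal scores. -/
def qStar {𝒵 : Type*} {d n : ℕ} (K : Set (E d)) (loss : E d → 𝒵 → ℝ) (s : 𝒵 → E d → ℝ)
    (h : SGDParams d) (α : ℝ) (ω : Sample 𝒵 d n) : ℝ :=
  orderStat (fun i : Fin (n + 1) => idealScore K loss s h i ω) (targetRank α n)

/-! ### Assumptions -/

/-- Model stability at sample size `n`: `ℙ(‖θ_{n+1} - θ_n‖ > u) ≤ δ`. -/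
def ModelStable {𝒵 : Type*} [MeasurableSpace 𝒵] {d : ℕ} (P : Measure 𝒵) (K : Set (E d))
    (loss : E d → 𝒵 → ℝ) (h : SGDParams d) (n : ℕ) (u δ : ℝ) : Prop :=
  (sampleMeasure P d n h.q).real
    {ω | u < ‖thetaIdeal K loss h ω - thetaActual K loss h ω‖} ≤ δ

/-- Almost surely, two given ideal scores are different. -/
def NoTies {𝒵 : Type*} [MeasurableSpace 𝒵] {d : ℕ} (P : Measure 𝒵) (K : Set (E d))
    (loss : E d → 𝒵 → ℝ) (s : 𝒵 → E d → ℝ) (h : SGDParams d) (n : ℕ) : Prop :=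
  ∀ i j : Fin (n + 1), i ≠ j →
    sampleMeasure P d n h.q {ω | idealScore K loss s h i ω = idealScore K loss s h j ω} = 0

/-- One-sided anti-concentration of the ideal scores around `q_*`. -/
def AntiConcentrated {𝒵 : Type*} [MeasurableSpace 𝒵] {d : ℕ} (P : Measure 𝒵) (K : Set (E d))
    (loss : E d → 𝒵 → ℝ) (s : 𝒵 → E d → ℝ) (h : SGDParams d) (α : ℝ) (n : ℕ)
    (fbar ρ : ℝ) : Prop :=
  ∀ ε : ℝ, 0 < ε → ε ≤ ρ → ∀ i : Fin (n + 1),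
    (sampleMeasure P d n h.q).real
      {ω | qStar K loss s h α ω < idealScore K loss s h i ω ∧
        idealScore K loss s h i ω ≤ qStar K loss s h α ω + ε} ≤ fbar * ε ∧
    (sampleMeasure P d n h.q).real
      {ω | qStar K loss s h α ω - ε ≤ idealScore K loss s h i ω ∧
        idealScore K loss s h i ω < qStar K loss s h α ω} ≤ fbar * ε

/-! ### Quantities in the coverage bound -/

/-- `E_n = (1 - (1-q)^{n+1}) / ((n+1) L) · (2C + σ √d) · (e^{η L T} - 1)`. -/
def stabilityRate {d : ℕ} (L : ℝ) (h : SGDParams d) (n : ℕ) : ℝ :=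
  (1 - (1 - (h.q : ℝ)) ^ (n + 1)) / (((n : ℝ) + 1) * L) * (2 * h.C + h.σ * √(d : ℝ)) *
    (Real.exp (h.η * L * h.T) - 1)

/-- The stability buffer `⌈n f̄ L u / δ⌉`. -/
def buffer (fbar L u δ : ℝ) (n : ℕ) : ℕ := ⌈(n : ℝ) * fbar * L * u / δ⌉₊

/-- The coverage lower bound `(1 - β) (1 - α - 2 f̄ L u - 3 δ - 1 / (n + 1))`. -/
def coverageBound (α β fbar L u δ : ℝ) (n : ℕ) : ℝ :=
  (1 - β) * (1 - α - 2 * fbar * L * u - 3 * δ - 1 / ((n : ℝ) + 1))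

end DPSCP

end

open DPSCP

/-! Stability. Metric projection and norm clipping (the projection onto a ball) are nonexpansive.
Hence one coupled step multiplies the distance of the two iterates by at most `1 + η L` and adds `η
(2C + σ‖ξ‖) / |B|` when the extra point lies in the larger run's minibatch `B`, nothing otherwise
(`norm_sgdStep_sub_le`). By symmetry the expected value of `1 / |B|` on the event that a given point
is selected is `ℙ(B ≠ ∅) / (n + 1)`, the mask is independent of `ξ`, and `𝔼‖ξ‖ ≤ √d`. Unrolling the
recursion and summing the geometric series gives `E_n` (`integral_deviationBound_le`), and Markov's
inequality gives model stability.

Coverage. The model trained on all `n + 1` points is a symmetric function of them, so the ideal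
scores are exchangeable and the test score lies strictly below `q_*` with probability at least `1 -
α - 1 / (n + 1)`. On the stable event each actual score is within `ε = L u` of its ideal score.
Anti-concentration is used on both sides of `q_*`: below, it makes it unlikely that the test score
is within `ε` of `q_*`; above, through Markov's inequality, it bounds by the buffer the number of
calibration scores that the perturbation can move past the test score. A counting argument
(`le_threshold_of_count`) then shows that any threshold dominating `r + m_n` actual calibration
scores covers the test point. The search returns such a threshold if all its noises stay below a
common quantile (`count_searchBracket`), which has probability at least `1 - β` independently of
everything else; hence the product form of the bound.

Asymptotics. `E_n = O(1/n)` because `η L T` stays bounded; so `u_n` and `δ_n` vanish, and `n u_n /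
δ_n` is of order `n E_n^{1/3} = O(n^{2/3})`. -/

namespace DPSCP

/-! ### Projection and clipping -/

section Projection

variable {F : Type*} [NormedAddCommGroup F] [InnerProductSpace ℝ F]

/-- Points satisfying the variational inequality of the metric projection depend on the projected
point in a nonexpansive way. -/
lemma norm_sub_le_of_inner_le_zero {K : Set F} {x y p q : F} (hp : p ∈ K) (hq : q ∈ K)
    (hxp : ∀ w ∈ K, inner ℝ (x - p) (w - p) ≤ 0) (hyq : ∀ w ∈ K, inner ℝ (y - q) (w - q) ≤ 0) :
    ‖p - q‖ ≤ ‖x - y‖ := by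
  have h1 := hxp q hq
  have h2 := hyq p hp
  -- With the two variational inequalities this yields `‖p - q‖² ≤ ⟪x - y, p - q⟫`; Cauchy–Schwarz
  -- finishes.
  have h3 : inner ℝ (x - y) (p - q) =
      ‖p - q‖ ^ 2 - inner ℝ (x - p) (q - p) - inner ℝ (y - q) (p - q) := by
    rw [← real_inner_self_eq_norm_sq]
    simp only [inner_sub_left, inner_sub_right]
    ring
  have h4 := real_inner_le_norm (x - y) (p - q)
  by_contra! hlt
  nlinarith [norm_nonneg (x - y), norm_nonneg (p - q)]

end Projection

lemma proj_spec {d : ℕ} {K : Set (E d)} (hne : K.Nonempty) (hcl : IsClosed K) (hcv : Convex ℝ K)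
    (x : E d) : proj K x ∈ K ∧ ∀ w ∈ K, ‖x - proj K x‖ ≤ ‖x - w‖ := by
  refine Classical.epsilon_spec (p := fun y => y ∈ K ∧ ∀ w ∈ K, ‖x - y‖ ≤ ‖x - w‖) ?_
  obtain ⟨v, hv, hmin⟩ := exists_norm_eq_iInf_of_complete_convex hne hcl.isComplete hcv x
  exact ⟨v, hv, fun w hw => hmin ▸
    ciInf_le ⟨0, Set.forall_mem_range.2 fun _ => norm_nonneg _⟩ (⟨w, hw⟩ : K)⟩

lemma proj_mem {d : ℕ} {K : Set (E d)} (hne : K.Nonempty) (hcl : IsClosed K) (hcv : Convex ℝ K)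
    (x : E d) : proj K x ∈ K := (proj_spec hne hcl hcv x).1

lemma proj_inner_le_zero {d : ℕ} {K : Set (E d)} (hne : K.Nonempty) (hcl : IsClosed K)
    (hcv : Convex ℝ K) (x : E d) : ∀ w ∈ K, inner ℝ (x - proj K x) (w - proj K x) ≤ 0 := by
  obtain ⟨hmem, hmin⟩ := proj_spec hne hcl hcv x
  have : Nonempty K := hne.to_subtype
  exact (norm_eq_iInf_iff_real_inner_le_zero hcv hmem).1 <|
    le_antisymm (le_ciInf fun w => hmin w w.2)
      (ciInf_le ⟨0, Set.forall_mem_range.2 fun _ => norm_nonneg _⟩ (⟨_, hmem⟩ : K))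

lemma norm_proj_sub_proj_le {d : ℕ} {K : Set (E d)} (hne : K.Nonempty) (hcl : IsClosed K)
    (hcv : Convex ℝ K) (x y : E d) : ‖proj K x - proj K y‖ ≤ ‖x - y‖ :=
  norm_sub_le_of_inner_le_zero (proj_mem hne hcl hcv x) (proj_mem hne hcl hcv y)
    (proj_inner_le_zero hne hcl hcv x) (proj_inner_le_zero hne hcl hcv y)

/-- A point of `K` is its own projection. This handles a step in which one run is projected while
the other stays where it is. -/
lemma norm_proj_sub_le {d : ℕ} {K : Set (E d)} (hne : K.Nonempty) (hcl : IsClosed K)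
    (hcv : Convex ℝ K) (x : E d) {y : E d} (hy : y ∈ K) : ‖proj K x - y‖ ≤ ‖x - y‖ :=
  norm_sub_le_of_inner_le_zero (proj_mem hne hcl hcv x) hy
    (proj_inner_le_zero hne hcl hcv x) (by simp)

lemma continuous_proj {d : ℕ} {K : Set (E d)} (hne : K.Nonempty) (hcl : IsClosed K)
    (hcv : Convex ℝ K) : Continuous (proj K) :=
  (LipschitzWith.of_dist_le_mul (K := 1) fun x y => by
    simpa [dist_eq_norm] using norm_proj_sub_proj_le hne hcl hcv x y).continuous

lemma norm_clip_le {d : ℕ} {C : ℝ} (hC : 0 < C) (g : E d) : ‖clip C g‖ ≤ C := by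
  have h0 : 0 ≤ min 1 (C / ‖g‖) := by positivity
  rw [clip, norm_smul, Real.norm_of_nonneg h0]
  rcases eq_or_ne ‖g‖ 0 with hg | hg
  · simp [hg, hC.le]
  · calc min 1 (C / ‖g‖) * ‖g‖ ≤ C / ‖g‖ * ‖g‖ := by gcongr; exact min_le_right _ _
      _ = C := div_mul_cancel₀ _ hg

/-- Clipping is the metric projection onto the ball of radius `C`; its variational inequality makes
clipping nonexpansive, so clipped gradients keep the Lipschitz constant of the gradients. -/
lemma clip_inner_le_zero {d : ℕ} {C : ℝ} (hC : 0 < C) (g : E d) :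
    ∀ w ∈ Metric.closedBall (0 : E d) C, inner ℝ (g - clip C g) (w - clip C g) ≤ 0 := by
  intro w hw
  rw [mem_closedBall_zero_iff] at hw
  rcases le_or_gt ‖g‖ C with hg | hg
  · have : clip C g = g := by
      rcases eq_or_ne g 0 with rfl | h0
      · simp [clip]
      · rw [clip, min_eq_left ((one_le_div (norm_pos_iff.2 h0)).2 hg), one_smul]
    simp [this]
  · have hg0 : 0 < ‖g‖ := hC.trans hg
    have hclip : clip C g = (C / ‖g‖) • g := by
      rw [clip, min_eq_right ((div_le_one hg0).2 hg.le)]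
    have h1 : g - clip C g = (1 - C / ‖g‖) • g := by rw [hclip, sub_smul, one_smul]
    have h2 : 0 ≤ 1 - C / ‖g‖ := sub_nonneg.2 ((div_le_one hg0).2 hg.le)
    have h3 : inner ℝ g (w - clip C g) ≤ 0 := by
      rw [inner_sub_right, hclip, inner_smul_right, real_inner_self_eq_norm_sq]
      have h4 : C / ‖g‖ * ‖g‖ ^ 2 = ‖g‖ * C := by field_simp
      have h5 := real_inner_le_norm g w
      have h6 : ‖g‖ * ‖w‖ ≤ ‖g‖ * C := by gcongr
      linarith
    rw [h1, real_inner_smul_left]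
    exact mul_nonpos_of_nonneg_of_nonpos h2 h3

lemma norm_clip_sub_clip_le {d : ℕ} {C : ℝ} (hC : 0 < C) (g g' : E d) :
    ‖clip C g - clip C g'‖ ≤ ‖g - g'‖ :=
  norm_sub_le_of_inner_le_zero (K := Metric.closedBall 0 C)
    (mem_closedBall_zero_iff.2 (norm_clip_le hC g))
    (mem_closedBall_zero_iff.2 (norm_clip_le hC g')) (clip_inner_le_zero hC g)
    (clip_inner_le_zero hC g')

lemma continuous_clip {d : ℕ} {C : ℝ} (hC : 0 < C) : Continuous (clip C : E d → E d) :=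
  (LipschitzWith.of_dist_le_mul (K := 1) fun x y => by
    simpa [dist_eq_norm] using norm_clip_sub_clip_le hC x y).continuous

/-! ### Pathwise stability of the synchronized coupling -/

/-- The minibatch selected by an inclusion mask. -/
def batch {m : ℕ} (b : Fin m → Bool) : Finset (Fin m) := Finset.univ.filter fun i => b i = true

/-- The weight `1 / |B|` of the point `i` in the minibatch average; `0` if `i` is not selected. -/
noncomputable def batchWeight {m : ℕ} (i : Fin m) (b : Fin m → Bool) : ℝ :=
  if b i = true then ((batch b).card : ℝ)⁻¹ else 0

lemma sum_batch_castSucc {M : Type*} [AddCommMonoid M] {n : ℕ} (b : Fin (n + 1) → Bool)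
    (f : Fin (n + 1) → M) :
    ∑ i ∈ batch b, f i = (∑ i ∈ batch fun i : Fin n => b i.castSucc, f i.castSucc) +
      if b (Fin.last n) = true then f (Fin.last n) else 0 := by
  simp only [batch, Finset.sum_filter, Fin.sum_univ_castSucc]

lemma card_batch_castSucc {n : ℕ} (b : Fin (n + 1) → Bool) :
    (batch b).card = (batch fun i : Fin n => b i.castSucc).card +
      if b (Fin.last n) = true then 1 else 0 := by
  simp only [Finset.card_eq_sum_ones, sum_batch_castSucc b]

section Coupling

variable {𝒵 : Type*} {d : ℕ} {K : Set (E d)} {loss : E d → 𝒵 → ℝ} {h : SGDParams d}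

lemma sgdStep_of_batch_eq_empty {m : ℕ} {z : Fin m → 𝒵} {b : Fin m → Bool} {ξ θ : E d}
    (hb : batch b = ∅) : sgdStep K loss h z b ξ θ = θ := if_pos hb

lemma sgdStep_of_batch_ne_empty {m : ℕ} {z : Fin m → 𝒵} {b : Fin m → Bool} {ξ θ : E d}
    (hb : batch b ≠ ∅) : sgdStep K loss h z b ξ θ =
      proj K (θ - h.η • (((batch b).card : ℝ)⁻¹ •
        (∑ i ∈ batch b, clip h.C (gradient (fun θ' => loss θ' (z i)) θ) + h.σ • ξ))) :=
  if_neg hb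

variable (hne : K.Nonempty) (hcl : IsClosed K) (hcv : Convex ℝ K)

include hne hcl hcv in
lemma sgdStep_mem {m : ℕ} (z : Fin m → 𝒵) (b : Fin m → Bool) (ξ : E d) {θ : E d} (hθ : θ ∈ K) :
    sgdStep K loss h z b ξ θ ∈ K := by
  by_cases hb : batch b = ∅
  · rwa [sgdStep_of_batch_eq_empty hb]
  · rw [sgdStep_of_batch_ne_empty hb]
    exact proj_mem hne hcl hcv _

include hne hcl hcv in
lemma sgdIter_mem (h0 : h.θ₀ ∈ K) {m : ℕ} (z : Fin m → 𝒵) (b : ℕ → Fin m → Bool) (ξ : ℕ → E d)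
    (t : ℕ) : sgdIter K loss h z b ξ t ∈ K := by
  induction t with
  | zero => exact h0
  | succ t ih => exact sgdStep_mem hne hcl hcv z (b t) (ξ t) ih

lemma norm_gradStep_sub_le {η L : ℝ} (hη : 0 ≤ η) {θ θ' v v' : E d} {c : ℝ}
    (hv : ‖v - v'‖ ≤ L * ‖θ - θ'‖ + c) :
    ‖(θ - η • v) - (θ' - η • v')‖ ≤ (1 + η * L) * ‖θ - θ'‖ + η * c := by
  have h1 : (θ - η • v) - (θ' - η • v') = (θ - θ') - η • (v - v') := by
    rw [smul_sub]; abel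
  calc ‖(θ - η • v) - (θ' - η • v')‖ ≤ ‖θ - θ'‖ + η * ‖v - v'‖ := by
        rw [h1]
        refine (norm_sub_le _ _).trans_eq ?_
        rw [norm_smul, Real.norm_of_nonneg hη]
    _ ≤ ‖θ - θ'‖ + η * (L * ‖θ - θ'‖ + c) := by gcongr
    _ = _ := by ring

/-- The change of normalisation from `k` to `k + 1` costs `(k + 1)⁻¹` times the old average `k⁻¹ •
(G + v)`, of norm at most `C + ‖v‖`; the inserted gradient contributes the other `C`. This is the
origin of `2C + σ‖ξ‖`. -/
lemma norm_average_insert_sub_le {G G' g v : E d} {k D C : ℝ} (hk1 : 1 ≤ k)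
    (hGG : ‖G' - G‖ ≤ k * D) (hD : 0 ≤ D) (hG : ‖G‖ ≤ k * C) (hg : ‖g‖ ≤ C) :
    ‖(k + 1)⁻¹ • (G' + g + v) - k⁻¹ • (G + v)‖ ≤ D + (k + 1)⁻¹ * (2 * C + ‖v‖) := by
  have hk : 0 < k := by linarith
  have e : (k + 1)⁻¹ • (G' + g + v) - k⁻¹ • (G + v) =
      (k + 1)⁻¹ • ((G' - G) + g - k⁻¹ • (G + v)) := by
    match_scalars <;> field_simp <;> ring
  have hv : k⁻¹ * ‖G + v‖ ≤ C + ‖v‖ := by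
    calc k⁻¹ * ‖G + v‖ ≤ k⁻¹ * (k * C + ‖v‖) := by
          gcongr; exact (norm_add_le _ _).trans (by gcongr)
      _ = C + k⁻¹ * ‖v‖ := by field_simp
      _ ≤ C + 1 * ‖v‖ := by gcongr; exact inv_le_one_of_one_le₀ hk1
      _ = _ := by ring
  have hn : ‖(G' - G) + g - k⁻¹ • (G + v)‖ ≤ k * D + C + (C + ‖v‖) := by
    refine (norm_sub_le _ _).trans (add_le_add ((norm_add_le _ _).trans (by gcongr)) ?_)
    rwa [norm_smul, Real.norm_of_nonneg (by positivity)]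
  calc _ = (k + 1)⁻¹ * ‖(G' - G) + g - k⁻¹ • (G + v)‖ := by
        rw [e, norm_smul, Real.norm_of_nonneg (by positivity)]
    _ ≤ (k + 1)⁻¹ * ((k + 1) * D + (2 * C + ‖v‖)) := by gcongr; linarith
    _ = _ := by field_simp

variable {Lg : ℝ} (hLg : 0 < Lg) (hη : 0 ≤ h.η) (hC : 0 < h.C) (hσ : 0 ≤ h.σ)
  (hsmooth : ∀ z, ∀ θ ∈ K, ∀ θ' ∈ K,
    ‖gradient (fun w => loss w z) θ - gradient (fun w => loss w z) θ'‖ ≤ Lg * ‖θ - θ'‖)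

include hne hcl hcv hLg hη hC hσ hsmooth in
/-- One step of the coupled recursions expands the distance by `1 + η L` and adds a term of order
`η / |B|` if the extra point is in the minibatch. -/
lemma norm_sgdStep_sub_le {n : ℕ} (z : Fin (n + 1) → 𝒵) (b : Fin (n + 1) → Bool) (ξ : E d)
    {θ θ' : E d} (hθ : θ ∈ K) (hθ' : θ' ∈ K) :
    ‖sgdStep K loss h z b ξ θ' -
        sgdStep K loss h (fun i : Fin n => z i.castSucc) (fun i => b i.castSucc) ξ θ‖ ≤
      (1 + h.η * Lg) * ‖θ' - θ‖ +
        h.η * (batchWeight (Fin.last n) b * (2 * h.C + h.σ * ‖ξ‖)) := by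
  set b' : Fin n → Bool := fun i => b i.castSucc with hb'
  set g : Fin (n + 1) → E d → E d := fun i θ => clip h.C (gradient (fun θ' => loss θ' (z i)) θ)
    with hg
  have hgC : ∀ i θ, ‖g i θ‖ ≤ h.C := fun i θ => norm_clip_le hC _
  have hgL : ∀ i, ‖g i θ' - g i θ‖ ≤ Lg * ‖θ' - θ‖ := fun i =>
    (norm_clip_sub_clip_le hC _ _).trans (hsmooth _ _ hθ' _ hθ)
  have hGG : ‖∑ i ∈ batch b', g i.castSucc θ' - ∑ i ∈ batch b', g i.castSucc θ‖ ≤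
      (batch b').card * (Lg * ‖θ' - θ‖) := by
    rw [← Finset.sum_sub_distrib, ← nsmul_eq_mul, ← Finset.sum_const]
    exact norm_sum_le_of_le _ fun i _ => hgL _
  have hG : ‖∑ i ∈ batch b', g i.castSucc θ‖ ≤ (batch b').card * h.C := by
    rw [← nsmul_eq_mul, ← Finset.sum_const]
    exact norm_sum_le_of_le _ fun i _ => hgC _ _
  have hcard := card_batch_castSucc b
  have hsum := sum_batch_castSucc b fun i => g i θ'
  have hξ : ‖h.σ • ξ‖ = h.σ * ‖ξ‖ := by rw [norm_smul, Real.norm_of_nonneg hσ]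
  by_cases hl : b (Fin.last n) = true
  · rw [if_pos hl] at hcard hsum
    have hne1 : batch b ≠ ∅ := by
      rw [← Finset.card_pos.trans Finset.nonempty_iff_ne_empty, hcard]; omega
    rw [sgdStep_of_batch_ne_empty hne1, batchWeight, if_pos hl, hsum]
    -- If the extra point is alone in the minibatch, the smaller run skips the step, so its
    -- displacement is `0` and the weight of the extra point is `1`.
    by_cases he : batch b' = ∅
    · rw [sgdStep_of_batch_eq_empty he, hcard, he]
      refine (norm_proj_sub_le hne hcl hcv _ hθ).trans ?_
      have := norm_gradStep_sub_le (L := Lg) hη (θ := θ') (θ' := θ) (v := g (Fin.last n) θ' + h.σ • ξ)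
        (v' := 0) (c := 2 * h.C + h.σ * ‖ξ‖) (by
          rw [sub_zero]
          refine (norm_add_le _ _).trans ?_
          rw [hξ]
          have := hgC (Fin.last n) θ'
          have : 0 ≤ Lg * ‖θ' - θ‖ := by positivity
          linarith)
      simpa using this
    · rw [sgdStep_of_batch_ne_empty he, hcard]
      refine (norm_proj_sub_proj_le hne hcl hcv _ _).trans (norm_gradStep_sub_le hη ?_)
      have hk : 1 ≤ (batch b').card := Finset.card_pos.2 (Finset.nonempty_iff_ne_empty.2 he)
      have hk1 : (1 : ℝ) ≤ (batch b').card := by exact_mod_cast hk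
      have := norm_average_insert_sub_le (v := h.σ • ξ) hk1 hGG (by positivity) hG
        (hgC (Fin.last n) θ')
      rw [hξ] at this
      simpa using this
  -- Both runs now use the same minibatch, so the shared noise cancels and only the expansion factor
  -- remains.
  · rw [if_neg hl, add_zero] at hcard hsum
    rw [batchWeight, if_neg hl, zero_mul]
    by_cases he : batch b' = ∅
    · have he1 : batch b = ∅ := by rw [← Finset.card_eq_zero, hcard, he, Finset.card_empty]
      rw [sgdStep_of_batch_eq_empty he, sgdStep_of_batch_eq_empty he1]
      have : 0 ≤ h.η * Lg * ‖θ' - θ‖ := by positivity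
      linarith
    · have hk : 1 ≤ (batch b').card := Finset.card_pos.2 (Finset.nonempty_iff_ne_empty.2 he)
      have hne1 : batch b ≠ ∅ := by
        rw [← Finset.card_pos.trans Finset.nonempty_iff_ne_empty, hcard]; exact hk
      rw [sgdStep_of_batch_ne_empty he, sgdStep_of_batch_ne_empty hne1, hcard, hsum]
      refine (norm_proj_sub_proj_le hne hcl hcv _ _).trans (norm_gradStep_sub_le hη ?_)
      have hk0 : (0 : ℝ) < (batch b').card := by exact_mod_cast hk
      rw [← smul_sub, add_sub_add_right_eq_sub, norm_smul, Real.norm_of_nonneg (by positivity),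
        add_zero, inv_mul_le_iff₀ hk0]
      exact hGG

/-- The pathwise bound on the distance of the coupled models after `t` steps. -/
noncomputable def deviationBound {n : ℕ} (Lg : ℝ) (h : SGDParams d) (b : ℕ → Fin (n + 1) → Bool) (ξ : ℕ → E d)
    (t : ℕ) : ℝ :=
  ∑ k ∈ Finset.range t, (1 + h.η * Lg) ^ (t - 1 - k) *
    (h.η * (batchWeight (Fin.last n) (b k) * (2 * h.C + h.σ * ‖ξ k‖)))

lemma deviationBound_succ {n : ℕ} (b : ℕ → Fin (n + 1) → Bool) (ξ : ℕ → E d) (t : ℕ) :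
    deviationBound Lg h b ξ (t + 1) = (1 + h.η * Lg) * deviationBound Lg h b ξ t +
      h.η * (batchWeight (Fin.last n) (b t) * (2 * h.C + h.σ * ‖ξ t‖)) := by
  rw [deviationBound, deviationBound, Finset.sum_range_succ, Finset.mul_sum]
  congr 1
  · refine Finset.sum_congr rfl fun k hk => ?_
    rw [← mul_assoc (1 + h.η * Lg), ← pow_succ']
    congr 2
    have := Finset.mem_range.1 hk
    omega
  · simp

include hne hcl hcv hLg hη hC hσ hsmooth in
lemma norm_thetaIdeal_sub_thetaActual_le (h0 : h.θ₀ ∈ K) {n : ℕ} (ω : Sample 𝒵 d n) :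
    ‖thetaIdeal K loss h ω - thetaActual K loss h ω‖ ≤
      deviationBound Lg h ω.1.2 ω.2.1 h.T := by
  rw [thetaIdeal, thetaActual]
  generalize h.T = t
  induction t with
  | zero => simp [sgdIter, deviationBound]
  | succ t ih =>
    rw [deviationBound_succ]
    refine (norm_sgdStep_sub_le hne hcl hcv hLg hη hC hσ hsmooth ω.1.1 (ω.1.2 t) (ω.2.1 t)
      (sgdIter_mem hne hcl hcv h0 _ _ _ t) (sgdIter_mem hne hcl hcv h0 _ _ _ t)).trans ?_
    gcongr

end Coupling

/-! ### Expected deviation and model stability -/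

lemma integrable_norm_stdGaussian (d : ℕ) : Integrable (fun x : E d => ‖x‖) (stdGaussian (E d)) :=
  (IsGaussian.integrable_id (μ := stdGaussian (E d))).norm

lemma integral_norm_sq_stdGaussian (d : ℕ) : ∫ x, ‖x‖ ^ 2 ∂(stdGaussian (E d)) = d := by
  have hint : Integrable (fun x : ℝ => x ^ 2) (gaussianReal 0 1) :=
    (memLp_id_gaussianReal (μ := 0) (v := 1) 2).integrable_sq
  have hone : ∫ x, x ^ 2 ∂(gaussianReal 0 1) = 1 := by
    have := variance_id_gaussianReal (μ := 0) (v := 1)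
    rw [variance_eq_sub (memLp_id_gaussianReal 2)] at this
    simpa using this
  rw [← map_pi_eq_stdGaussian, integral_map (by fun_prop) (by fun_prop)]
  simp_rw [EuclideanSpace.real_norm_sq_eq]
  rw [integral_finsetSum _ fun i _ => integrable_comp_eval (i := i) hint]
  have : ∀ i : Fin d, ∫ x : Fin d → ℝ, x i ^ 2 ∂(Measure.pi fun _ => gaussianReal 0 1) = 1 :=
    fun i => (integral_comp_eval (μ := fun _ => gaussianReal 0 1) (i := i) (f := fun x : ℝ => x ^ 2)
      hint.aestronglyMeasurable).trans hone
  simp [this]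

/-- Nonnegativity of the variance of `‖ξ‖` gives `(𝔼‖ξ‖)² ≤ 𝔼‖ξ‖² = d`. -/
lemma integral_norm_stdGaussian_le (d : ℕ) : ∫ x, ‖x‖ ∂(stdGaussian (E d)) ≤ √(d : ℝ) := by
  have hm : MemLp (fun x : E d => ‖x‖) 2 (stdGaussian (E d)) :=
    (IsGaussian.memLp_two_id (μ := stdGaussian (E d))).norm
  have := variance_nonneg (fun x : E d => ‖x‖) (stdGaussian (E d))
  rw [variance_eq_sub hm] at this
  refine Real.le_sqrt_of_sq_le ?_
  rw [← integral_norm_sq_stdGaussian]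
  simpa using this

/-- The law of an inclusion mask. -/
noncomputable abbrev maskMeasure (m : ℕ) (q : unitInterval) : Measure (Fin m → Bool) :=
  Measure.pi fun _ => bernoulliMeasure true false q

/-! ### Permutation symmetry of minibatches -/

section Permutation

variable {m : ℕ} (e : Equiv.Perm (Fin m))

/-- Reindexing a vector by a permutation. -/
abbrev permute (X : Type*) [MeasurableSpace X] : (Fin m → X) ≃ᵐ (Fin m → X) :=
  MeasurableEquiv.piCongrLeft (fun _ => X) e

lemma permute_apply {X : Type*} [MeasurableSpace X] (x : Fin m → X) (i : Fin m) :
    permute e X x (e i) = x i :=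
  MeasurableEquiv.piCongrLeft_apply_apply (β := fun _ => X) e x i

lemma measurePreserving_permute {X : Type*} [MeasurableSpace X] (μ : Measure X) [SigmaFinite μ] :
    MeasurePreserving (permute e X) (Measure.pi fun _ => μ) (Measure.pi fun _ => μ) :=
  measurePreserving_piCongrLeft (fun _ => μ) e

lemma sum_batch_permute {M : Type*} [AddCommMonoid M] (b : Fin m → Bool) (f : Fin m → M) :
    ∑ i ∈ batch (permute e Bool b), f i = ∑ i ∈ batch b, f (e i) := by
  simp only [batch, Finset.sum_filter]
  rw [← Equiv.sum_comp e]
  simp only [permute_apply]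

lemma card_batch_permute (b : Fin m → Bool) :
    (batch (permute e Bool b)).card = (batch b).card := by
  simp only [Finset.card_eq_sum_ones, sum_batch_permute]

lemma batchWeight_permute (b : Fin m → Bool) (i : Fin m) :
    batchWeight (e i) (permute e Bool b) = batchWeight i b := by
  rw [batchWeight, batchWeight, permute_apply, card_batch_permute]

end Permutation

/-- The `|B|` selected points carry weight `1 / |B|` each, so the total fails to be `1` only for the
empty minibatch. -/
lemma sum_batchWeight {m : ℕ} (b : Fin m → Bool) :
    ∑ i, batchWeight i b = 1 - Set.indicator {fun _ => false} (fun _ => (1 : ℝ)) b := by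
  have h1 : ∑ i, batchWeight i b = (batch b).card * ((batch b).card : ℝ)⁻¹ := by
    simp only [batchWeight]
    rw [← Finset.sum_filter, Finset.sum_const, nsmul_eq_mul]
    rfl
  rw [h1]
  by_cases hb : b = fun _ => false
  · subst hb
    simp [batch]
  · have : (batch b).card ≠ 0 := by
      intro h0
      apply hb
      funext i
      rw [Finset.card_eq_zero, batch, Finset.filter_eq_empty_iff] at h0
      simpa using h0 (Finset.mem_univ i)
    rw [mul_inv_cancel₀ (by exact_mod_cast this), Set.indicator_of_notMem (by simpa using hb),
      sub_zero]

/-- By symmetry, each point carries the same share of the probability of a nonempty minibatch. -/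
lemma integral_batchWeight {n : ℕ} (q : unitInterval) :
    ∫ b, batchWeight (Fin.last n) b ∂(maskMeasure (n + 1) q) =
      (1 - (1 - (q : ℝ)) ^ (n + 1)) / ((n : ℝ) + 1) := by
  have hsymm : ∀ i, ∫ b, batchWeight i b ∂(maskMeasure (n + 1) q) =
      ∫ b, batchWeight (Fin.last n) b ∂(maskMeasure (n + 1) q) := fun i => by
    rw [← (measurePreserving_permute (Equiv.swap i (Fin.last n)) _).integral_comp'
      (g := batchWeight (Fin.last n))]
    refine integral_congr_ae (Eventually.of_forall fun b => ?_)
    have := batchWeight_permute (Equiv.swap i (Fin.last n)) b i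
    rw [Equiv.swap_apply_left] at this
    exact this.symm
  have hsum : ∑ i, ∫ b, batchWeight i b ∂(maskMeasure (n + 1) q) =
      1 - (1 - (q : ℝ)) ^ (n + 1) := by
    rw [← integral_finsetSum _ fun i _ => Integrable.of_finite]
    simp_rw [sum_batchWeight]
    rw [integral_sub Integrable.of_finite Integrable.of_finite,
      integral_indicator_const _ (measurableSet_singleton _), measureReal_def, Measure.pi_singleton]
    have : bernoulliMeasure true false q {false} = ENNReal.ofReal (1 - (q : ℝ)) := by
      rw [← ofReal_measureReal, bernoulliMeasure_real_apply_of_notMem_of_mem] <;> simp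
    have h1 : 0 ≤ 1 - (q : ℝ) := sub_nonneg.2 q.2.2
    simp [this, ENNReal.toReal_ofReal h1]
  rw [Finset.sum_congr rfl fun i _ => hsymm i] at hsum
  rw [eq_div_iff (by positivity), ← hsum]
  simp [mul_comm]

section Stability

variable {𝒵 : Type*} [MeasurableSpace 𝒵] (P : Measure 𝒵) [IsProbabilityMeasure P] {d n : ℕ}
  (q : unitInterval)

instance : IsProbabilityMeasure (sampleMeasure P d n q) := by
  unfold sampleMeasure; infer_instance

lemma measurePreserving_mask (k : ℕ) :
    MeasurePreserving (fun x : (Fin (n + 1) → 𝒵) × (ℕ → Fin (n + 1) → Bool) => x.2 k)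
      ((Measure.pi fun _ => P).prod (Measure.infinitePi fun _ : ℕ => maskMeasure (n + 1) q))
      (maskMeasure (n + 1) q) :=
  (measurePreserving_eval_infinitePi (fun _ : ℕ => maskMeasure (n + 1) q) k).comp
    measurePreserving_snd

lemma measurePreserving_gaussianVector (k : ℕ) :
    MeasurePreserving (fun x : (ℕ → E d) × (ℕ → ℝ) => x.1 k)
      ((Measure.infinitePi fun _ : ℕ => stdGaussian (E d)).prod
        (Measure.infinitePi fun _ : ℕ => gaussianReal 0 1))
      (stdGaussian (E d)) :=
  (measurePreserving_eval_infinitePi (fun _ : ℕ => stdGaussian (E d)) k).comp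
    measurePreserving_fst

lemma integrable_deviation_term (k : ℕ) (c σ : ℝ) :
    Integrable (fun ω : Sample 𝒵 d n => batchWeight (Fin.last n) (ω.1.2 k) * (c + σ * ‖ω.2.1 k‖))
      (sampleMeasure P d n q) :=
  Integrable.mul_prod
    (((measurePreserving_mask P q k).integrable_comp (g := batchWeight (Fin.last n))
      Integrable.of_finite.aestronglyMeasurable).2 Integrable.of_finite)
    (((measurePreserving_gaussianVector k).integrable_comp (g := fun ξ => c + σ * ‖ξ‖)
      (by fun_prop)).2
      ((integrable_const _).add ((integrable_norm_stdGaussian d).const_mul σ)))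

/-- The mask and the Gaussian vector sit in different factors of the product measure, so the
expectation factorises. -/
lemma integral_deviation_term_le (k : ℕ) {c σ : ℝ} (hσ : 0 ≤ σ) :
    ∫ ω, batchWeight (Fin.last n) (ω.1.2 k) * (c + σ * ‖ω.2.1 k‖) ∂(sampleMeasure P d n q) ≤
      (1 - (1 - (q : ℝ)) ^ (n + 1)) / ((n : ℝ) + 1) * (c + σ * √(d : ℝ)) := by
  have h1 := integral_prod_mul
    (μ := (Measure.pi fun _ : Fin (n + 1) => P).prod
      (Measure.infinitePi fun _ : ℕ => maskMeasure (n + 1) q))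
    (ν := (Measure.infinitePi fun _ : ℕ => stdGaussian (E d)).prod
        (Measure.infinitePi fun _ : ℕ => gaussianReal 0 1))
    (fun x => batchWeight (Fin.last n) (x.2 k)) (fun x => c + σ * ‖x.1 k‖)
  have h2 : ∫ x, batchWeight (Fin.last n) (x.2 k) ∂((Measure.pi fun _ : Fin (n + 1) => P).prod
      (Measure.infinitePi fun _ : ℕ => maskMeasure (n + 1) q)) =
      (1 - (1 - (q : ℝ)) ^ (n + 1)) / ((n : ℝ) + 1) := by
    have := integral_map (measurePreserving_mask (n := n) P q k).aemeasurable
      (f := batchWeight (Fin.last n)) (by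
        rw [(measurePreserving_mask P q k).map_eq]
        exact Integrable.of_finite.aestronglyMeasurable)
    rw [← this, (measurePreserving_mask P q k).map_eq, integral_batchWeight]
  have h3 : ∫ x, c + σ * ‖x.1 k‖ ∂((Measure.infinitePi fun _ : ℕ => stdGaussian (E d)).prod
        (Measure.infinitePi fun _ : ℕ => gaussianReal 0 1)) ≤ c + σ * √(d : ℝ) := by
    have := integral_map (measurePreserving_gaussianVector (d := d) k).aemeasurable
      (f := fun ξ => c + σ * ‖ξ‖) (by fun_prop)
    rw [← this, (measurePreserving_gaussianVector k).map_eq,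
      integral_add (integrable_const _) ((integrable_norm_stdGaussian d).const_mul σ),
      integral_const_mul]
    have := integral_norm_stdGaussian_le d
    simp only [integral_const, probReal_univ, one_smul]
    gcongr
  refine h1.trans_le ?_
  rw [h2]
  have : (1 - (q : ℝ)) ^ (n + 1) ≤ 1 :=
    pow_le_one₀ (sub_nonneg.2 q.2.2) (by linarith [q.2.1])
  exact mul_le_mul_of_nonneg_left h3 (div_nonneg (by linarith) (by positivity))

variable {h : SGDParams d} {Lg : ℝ} (hLg : 0 < Lg) (hη : 0 ≤ h.η) (hC : 0 < h.C) (hσ : 0 ≤ h.σ)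

lemma integrable_deviationBound :
    Integrable (fun ω : Sample 𝒵 d n => deviationBound Lg h ω.1.2 ω.2.1 h.T)
      (sampleMeasure P d n q) :=
  integrable_finsetSum _ fun _ _ =>
    ((integrable_deviation_term P q _ _ _).const_mul _).const_mul _

include hLg hη hC hσ in
lemma integral_deviationBound_le :
    ∫ ω, deviationBound Lg h ω.1.2 ω.2.1 h.T ∂(sampleMeasure P d n h.q) ≤
      stabilityRate Lg h n := by
  set p : ℝ := (1 - (1 - (h.q : ℝ)) ^ (n + 1)) / ((n : ℝ) + 1) with hp
  set c : ℝ := 2 * h.C + h.σ * √(d : ℝ) with hc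
  have hp0 : 0 ≤ p := by
    have : (1 - (h.q : ℝ)) ^ (n + 1) ≤ 1 :=
      pow_le_one₀ (sub_nonneg.2 h.q.2.2) (by linarith [h.q.2.1])
    exact div_nonneg (by linarith) (by positivity)
  have hgeom : (∑ k ∈ Finset.range h.T, (1 + h.η * Lg) ^ (h.T - 1 - k)) * (h.η * Lg) =
      (1 + h.η * Lg) ^ h.T - 1 := by
    rw [Finset.sum_range_reflect (fun k => (1 + h.η * Lg) ^ k) h.T]
    simpa using geom_sum_mul (1 + h.η * Lg) h.T
  have hexp : (1 + h.η * Lg) ^ h.T ≤ Real.exp (h.η * Lg * h.T) := by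
    rw [mul_comm _ (h.T : ℝ), Real.exp_nat_mul]
    have := Real.add_one_le_exp (h.η * Lg)
    gcongr
    linarith
  calc ∫ ω, deviationBound Lg h ω.1.2 ω.2.1 h.T ∂(sampleMeasure P d n h.q)
      = ∑ k ∈ Finset.range h.T, (1 + h.η * Lg) ^ (h.T - 1 - k) * (h.η *
          ∫ ω, batchWeight (Fin.last n) (ω.1.2 k) * (2 * h.C + h.σ * ‖ω.2.1 k‖)
            ∂(sampleMeasure P d n h.q)) := by
        simp only [deviationBound]
        rw [integral_finsetSum _ fun _ _ =>
          ((integrable_deviation_term P h.q _ _ _).const_mul _).const_mul _]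
        simp only [integral_const_mul]
    _ ≤ ∑ k ∈ Finset.range h.T, (1 + h.η * Lg) ^ (h.T - 1 - k) * (h.η * (p * c)) := by
        gcongr
        exact integral_deviation_term_le P h.q _ hσ
    -- Only `Lg` is divided out; the factor `η` stays with the geometric sum, so `η = 0` needs no
    -- separate case.
    _ = p * c / Lg * ((∑ k ∈ Finset.range h.T, (1 + h.η * Lg) ^ (h.T - 1 - k)) *
          (h.η * Lg)) := by
        rw [← Finset.sum_mul]
        field_simp
    _ ≤ p * c / Lg * (Real.exp (h.η * Lg * h.T) - 1) := by
        rw [hgeom]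
        gcongr
    _ = stabilityRate Lg h n := by
        rw [stabilityRate, hp]
        field_simp
        ring

/-- Markov's inequality is applied to the integrable pathwise majorant `deviationBound`, not to the
distance of the models itself. -/
lemma modelStable_of_stabilityRate_le {K : Set (E d)} {loss : E d → 𝒵 → ℝ} (hne : K.Nonempty)
    (hcl : IsClosed K) (hcv : Convex ℝ K) (hLg : 0 < Lg) (hη : 0 ≤ h.η) (hC : 0 < h.C)
    (hσ : 0 ≤ h.σ) (h0 : h.θ₀ ∈ K)
    (hsmooth : ∀ z, ∀ θ ∈ K, ∀ θ' ∈ K,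
      ‖gradient (fun w => loss w z) θ - gradient (fun w => loss w z) θ'‖ ≤ Lg * ‖θ - θ'‖)
    {u δ : ℝ} (hu : 0 < u) (hE : stabilityRate Lg h n ≤ u * δ) :
    ModelStable P K loss h n u δ := by
  have hdev := fun ω : Sample 𝒵 d n =>
    norm_thetaIdeal_sub_thetaActual_le hne hcl hcv hLg hη hC hσ hsmooth h0 ω
  have hmarkov := mul_meas_ge_le_integral_of_nonneg (μ := sampleMeasure P d n h.q)
    (Eventually.of_forall fun ω => (norm_nonneg _).trans (hdev ω))
    (integrable_deviationBound P h.q) u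
  refine le_of_mul_le_mul_left ?_ hu
  calc u * (sampleMeasure P d n h.q).real
        {ω | u < ‖thetaIdeal K loss h ω - thetaActual K loss h ω‖}
      ≤ u * (sampleMeasure P d n h.q).real
        {ω | u ≤ deviationBound Lg h ω.1.2 ω.2.1 h.T} := by
        refine mul_le_mul_of_nonneg_left (measureReal_mono fun ω hω => ?_) hu.le
        exact (le_of_lt hω).trans (hdev ω)
    _ ≤ _ := hmarkov
    _ ≤ _ := integral_deviationBound_le P hLg hη hC hσ
    _ ≤ u * δ := hE

end Stability

/-! ### Order statistics -/

section OrderStat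

variable {m : ℕ} {S : Fin m → ℝ} {k : ℕ}

lemma count_mono (S : Fin m → ℝ) : Monotone (count S) := fun _ _ hst =>
  Finset.card_le_card <| Finset.monotone_filter_right _ fun _ _ hi => le_trans hi hst

/-- Lowering `t` to the largest score not exceeding it leaves the count unchanged, so the infimum is
a minimum over finitely many scores. -/
lemma exists_orderStat_isLeast (hk : 1 ≤ k) (hkm : k ≤ m) (S : Fin m → ℝ) :
    ∃ i, IsLeast {t | k ≤ count S t} (S i) := by
  have key : ∀ t, k ≤ count S t → ∃ j, S j ≤ t ∧ k ≤ count S (S j) := by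
    intro t ht
    have hne : (Finset.univ.filter fun i => S i ≤ t).Nonempty :=
      Finset.card_pos.1 (lt_of_lt_of_le hk ht)
    obtain ⟨j, hj, hmax⟩ := Finset.exists_max_image _ S hne
    refine ⟨j, (Finset.mem_filter.1 hj).2, ht.trans (Finset.card_le_card fun i hi => ?_)⟩
    exact Finset.mem_filter.2 ⟨Finset.mem_univ _, hmax i hi⟩
  have hall : ∃ t, k ≤ count S t := by
    have hne : (Finset.univ : Finset (Fin m)).Nonempty := ⟨⟨0, by omega⟩, Finset.mem_univ _⟩
    obtain ⟨j, -, hmax⟩ := Finset.exists_max_image _ S hne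
    refine ⟨S j, ?_⟩
    rw [count, Finset.filter_true_of_mem hmax]
    simpa using hkm
  obtain ⟨t, ht⟩ := hall
  obtain ⟨j, -, hj⟩ := key t ht
  have hne : (Finset.univ.filter fun i => k ≤ count S (S i)).Nonempty :=
    ⟨j, Finset.mem_filter.2 ⟨Finset.mem_univ _, hj⟩⟩
  obtain ⟨i, hi, hmin⟩ := Finset.exists_min_image _ S hne
  refine ⟨i, (Finset.mem_filter.1 hi).2, fun t ht => ?_⟩
  obtain ⟨j, hjt, hj⟩ := key t ht
  exact (hmin j (Finset.mem_filter.2 ⟨Finset.mem_univ _, hj⟩)).trans hjt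

lemma orderStat_isLeast (hk : 1 ≤ k) (hkm : k ≤ m) (S : Fin m → ℝ) :
    IsLeast {t | k ≤ count S t} (orderStat S k) := by
  obtain ⟨i, hi⟩ := exists_orderStat_isLeast hk hkm S
  rwa [orderStat, hi.csInf_eq]

lemma orderStat_le_iff (hk : 1 ≤ k) (hkm : k ≤ m) {t : ℝ} :
    orderStat S k ≤ t ↔ k ≤ count S t :=
  ⟨fun h => (orderStat_isLeast hk hkm S).1.trans (count_mono S h),
    fun h => (orderStat_isLeast hk hkm S).2 h⟩

/-- The largest score strictly below the order statistic has count less than `k` by minimality, and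
its count includes every score strictly below. -/
lemma card_lt_orderStat_lt (hk : 1 ≤ k) (hkm : k ≤ m) :
    (Finset.univ.filter fun i => S i < orderStat S k).card < k := by
  rcases (Finset.univ.filter fun i => S i < orderStat S k).eq_empty_or_nonempty with he | hne
  · rw [he, Finset.card_empty]; omega
  · obtain ⟨j, hj, hmax⟩ := Finset.exists_max_image _ S hne
    have h1 : count S (S j) < k := by
      rw [← not_le, ← orderStat_le_iff hk hkm, not_le]
      exact (Finset.mem_filter.1 hj).2
    refine lt_of_le_of_lt (Finset.card_le_card fun i hi => ?_) h1
    exact Finset.mem_filter.2 ⟨Finset.mem_univ _, hmax i hi⟩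

lemma count_le_card_lt_add_one (hS : Function.Injective S) (t : ℝ) :
    count S t ≤ (Finset.univ.filter fun i => S i < t).card + 1 := by
  have h1 : (Finset.univ.filter fun i => S i = t).card ≤ 1 :=
    Finset.card_le_one.2 fun i hi j hj =>
      hS ((Finset.mem_filter.1 hi).2.trans (Finset.mem_filter.1 hj).2.symm)
  refine le_trans ?_ (Nat.add_le_add_left h1 _)
  refine (Finset.card_le_card fun i hi => ?_).trans (Finset.card_union_le _ _)
  simpa [le_iff_lt_or_eq] using hi

lemma le_card_lt_orderStat_add_one (hS : Function.Injective S) (hk : 1 ≤ k) (hkm : k ≤ m) :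
    k ≤ (Finset.univ.filter fun i => S i < orderStat S k).card + 1 :=
  ((orderStat_le_iff hk hkm).1 le_rfl).trans (count_le_card_lt_add_one hS _)

lemma count_orderStat_le (hS : Function.Injective S) (hk : 1 ≤ k) (hkm : k ≤ m) :
    count S (orderStat S k) ≤ k :=
  (count_le_card_lt_add_one hS _).trans (card_lt_orderStat_lt hk hkm)

lemma orderStat_comp_perm (e : Equiv.Perm (Fin m)) (S : Fin m → ℝ) (k : ℕ) :
    orderStat (S ∘ e) k = orderStat S k := by
  have : ∀ t, count (S ∘ e) t = count S t := fun t => by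
    simp only [count, Finset.card_filter, Function.comp]
    exact Equiv.sum_comp e fun i => if S i ≤ t then 1 else 0
  simp only [orderStat, this]

/-- If few scores lie just above the order statistic, a threshold that dominates `k + buf` of the
perturbed scores covers every perturbed score that started well below the order statistic. -/
lemma le_threshold_of_count {n : ℕ} {S S' : Fin (n + 1) → ℝ} (hS : Function.Injective S)
    (hk : 1 ≤ k) (hkn : k ≤ n + 1) {ε Q : ℝ} {buf : ℕ} (hclose : ∀ i, |S i - S' i| ≤ ε)
    (hlast : S (Fin.last n) < orderStat S k - ε)
    (hband : (Finset.univ.filter fun i : Fin n => orderStat S k < S i.castSucc ∧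
      S i.castSucc ≤ orderStat S k + ε).card ≤ buf)
    (hQ : k + buf ≤ count (fun i : Fin n => S' i.castSucc) Q) : S' (Fin.last n) ≤ Q := by
  have hε : 0 ≤ ε := (abs_nonneg _).trans (hclose (Fin.last n))
  set q := orderStat S k with hq
  by_contra! hlt
  have hl := abs_le.1 (hclose (Fin.last n))
  -- At most `k` of the `n + 1` scores are `≤ q`, and the last one is among them; at most `k - 1`
  -- remain for the others.
  have hle : (Finset.univ.filter fun i : Fin n => S i.castSucc ≤ q).card + 1 ≤ k := by
    refine le_trans (le_of_eq ?_) (count_orderStat_le hS hk hkn)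
    have : S (Fin.last n) ≤ q := by linarith
    simp only [count, Finset.card_filter, Fin.sum_univ_castSucc, ← hq, if_pos this]
  -- If `S' i ≤ Q < S' last`, two perturbations by at most `ε` and the margin `S last < q - ε` give
  -- `S i ≤ q + ε`: such a score is `≤ q` or in the band. Hence the count at `Q` is at most `k - 1 +
  -- buf`.
  have hsub : count (fun i : Fin n => S' i.castSucc) Q ≤
      (Finset.univ.filter fun i : Fin n => S i.castSucc ≤ q).card +
      (Finset.univ.filter fun i : Fin n => q < S i.castSucc ∧ S i.castSucc ≤ q + ε).card := by
    refine (Finset.card_le_card fun i hi => ?_).trans (Finset.card_union_le _ _)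
    have h1 := (Finset.mem_filter.1 hi).2
    have h2 := abs_le.1 (hclose i.castSucc)
    have h3 : S i.castSucc ≤ q + ε := by linarith
    simpa [h3] using le_or_gt (S i.castSucc) q
  omega

/-! ### The noisy binary search -/

/-- Loop invariant: the right endpoint always dominates at least `R` scores. It moves only if `count
+ σ ζ ≥ R + σ x - 1`; since `ζ < x`, this forces `count > R - 1`, hence `count ≥ R` by integrality.
This is why `τ` contains `-1`. -/
lemma count_searchBracket {a b r' σ x : ℝ} {R : ℕ} {ζ : ℕ → ℝ} (hσ : 0 < σ)
    (hr' : r' = R + (σ * x - 1)) (hb : R ≤ count S b) (N : ℕ) (hζ : ∀ k < N, ζ k < x) :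
    R ≤ count S (searchBracket S a b r' σ ζ N).2 := by
  induction N with
  | zero => exact hb
  | succ N ih =>
    have ih' := ih fun k hk => hζ k (hk.trans N.lt_succ_self)
    rw [searchBracket]
    split_ifs with hc
    · have h1 : σ * ζ N < σ * x := mul_lt_mul_of_pos_left (hζ N N.lt_succ_self) hσ
      have h2 : (R : ℝ) < count S (((searchBracket S a b r' σ ζ N).1 +
          (searchBracket S a b r' σ ζ N).2) / 2) + 1 := by linarith
      exact Nat.lt_succ_iff.1 (by exact_mod_cast h2)
    · exact ih'

end OrderStat

lemma le_cdf_normalQuantile {p : ℝ} (h1 : p < 1) :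
    p ≤ cdf (gaussianReal 0 1) (normalQuantile p) := by
  set F := cdf (gaussianReal 0 1) with hF
  have hne : {x | p ≤ F x}.Nonempty :=
    ((tendsto_cdf_atTop (gaussianReal 0 1)).eventually_const_le h1).exists
  by_contra! hlt
  -- If `F < p` at the quantile, then also at some `y` to its right; but the infimum provides `x <
  -- y` with `p ≤ F x ≤ F y`.
  have hright := (F.right_continuous (normalQuantile p)).tendsto.eventually_lt_const hlt
  obtain ⟨y, hyF, hy⟩ := ((hright.filter_mono (nhdsWithin_mono _ Set.Ioi_subset_Ici_self)).and
    (self_mem_nhdsWithin (s := Set.Ioi (normalQuantile p)))).exists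
  obtain ⟨x, hx, hxy⟩ := exists_lt_of_csInf_lt hne hy
  exact (hx.trans (F.mono hxy.le)).not_gt hyF

/-- The law of the noise of the quantile search. -/
noncomputable abbrev noiseMeasure : Measure (ℕ → ℝ) :=
  Measure.infinitePi fun _ : ℕ => gaussianReal 0 1

lemma one_sub_le_noiseMeasure {β : ℝ} (h0 : 0 < β) (h1 : β < 1) (N : ℕ) :
    1 - β ≤ noiseMeasure.real {ζ | ∀ k < N, ζ k < normalQuantile (1 - β / N)} := by
  rcases Nat.eq_zero_or_pos N with rfl | hN
  · simp [h0.le]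
  have hN' : (1 : ℝ) ≤ N := by exact_mod_cast hN
  set p := 1 - β / N with hp
  have hβN : β / N ≤ β := div_le_self h0.le hN'
  have hβN0 : 0 < β / N := by positivity
  have hset : {ζ : ℕ → ℝ | ∀ k < N, ζ k < normalQuantile p} =
      (Finset.range N : Set ℕ).pi fun _ => Set.Iio (normalQuantile p) := by
    ext ζ; simp [Set.pi]
  have hnoatom : (gaussianReal 0 1).real (Set.Iio (normalQuantile p)) =
      cdf (gaussianReal 0 1) (normalQuantile p) := by
    have : NullSingletonClass (gaussianReal 0 1) :=
      nullSingletonClass_gaussianReal one_ne_zero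
    rw [cdf_eq_real, measureReal_def, measureReal_def, measure_congr Iio_ae_eq_Iic]
  rw [hset, measureReal_def, Measure.infinitePi_pi _ fun _ _ => measurableSet_Iio,
    Finset.prod_const, Finset.card_range, ENNReal.toReal_pow, ← measureReal_def, hnoatom]
  -- Bernoulli's inequality: the `N` independent noises are all below the `1 - β / N` quantile with
  -- probability at least `(1 - β / N)^N ≥ 1 - β`.
  calc 1 - β = 1 + N * (-(β / N)) := by field_simp; ring
    _ ≤ (1 + -(β / N)) ^ N := one_add_mul_le_pow (by linarith) N
    _ ≤ _ := by
      rw [← sub_eq_add_neg, ← hp]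
      exact pow_le_pow_left₀ (by linarith) (le_cdf_normalQuantile (by linarith)) N

/-- The search noise is independent of the data and of the training. -/
lemma sampleMeasure_real_inter_noise {𝒵 : Type*} [MeasurableSpace 𝒵] (P : Measure 𝒵)
    [IsProbabilityMeasure P] (d n : ℕ) (q : unitInterval) (A : Set (Sample 𝒵 d n))
    (hA : ∀ ω : Sample 𝒵 d n, ω ∈ A → ∀ ζ, (ω.1, (ω.2.1, ζ)) ∈ A) (B : Set (ℕ → ℝ)) :
    (sampleMeasure P d n q).real (A ∩ {ω | ω.2.2 ∈ B}) =
      (sampleMeasure P d n q).real A * noiseMeasure.real B := by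
  set μ₁ := (Measure.pi fun _ : Fin (n + 1) => P).prod
    (Measure.infinitePi fun _ : ℕ => maskMeasure (n + 1) q)
  set μ₂ := Measure.infinitePi fun _ : ℕ => stdGaussian (E d)
  have hassoc := measurePreserving_prodAssoc μ₁ μ₂ noiseMeasure
  -- After reassociation the event is a rectangle: `A` does not depend on the search noise, so it
  -- may be sliced at noise `0`. The product formula holds for arbitrary sets, and `B = univ`
  -- identifies the measure of the slice with that of `A`.
  have key : ∀ B : Set (ℕ → ℝ), (sampleMeasure P d n q).real (A ∩ {ω | ω.2.2 ∈ B}) =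
      (μ₁.prod μ₂).real {x | (x.1, (x.2, (fun _ => 0 : ℕ → ℝ))) ∈ A} * noiseMeasure.real B := by
    intro B
    rw [← measureReal_prod_prod, measureReal_def, measureReal_def]
    congr 1
    refine (hassoc.measure_preimage_equiv _).symm.trans (congrArg _ ?_)
    ext ⟨⟨x, y⟩, ζ⟩
    exact and_congr_left fun _ => ⟨fun h => hA _ h _, fun h => hA _ h _⟩
  have huniv := key Set.univ
  rw [probReal_univ, mul_one] at huniv
  rw [key, ← huniv]
  simp

/-! ### Measurability and exchangeability of the ideal scores -/

/-- A Carathéodory function is jointly measurable. Restricting to the subtype `K` is needed because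
continuity is known only there; the iterates never leave `K`. -/
lemma measurable_comp_of_continuousOn {Ω 𝒵 β : Type*} [MeasurableSpace Ω] [MeasurableSpace 𝒵]
    [TopologicalSpace β] [TopologicalSpace.PseudoMetrizableSpace β] [MeasurableSpace β]
    [BorelSpace β] {d : ℕ} {K : Set (E d)} {f : E d → 𝒵 → β}
    (hcont : ∀ z, ContinuousOn (fun θ => f θ z) K) (hmeas : ∀ θ ∈ K, Measurable (f θ))
    {θ : Ω → E d} (hθ : Measurable θ) (hθK : ∀ ω, θ ω ∈ K) {z : Ω → 𝒵} (hz : Measurable z) :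
    Measurable fun ω => f (θ ω) (z ω) := by
  have h : Measurable (Function.uncurry fun (θ : K) (z : 𝒵) => f θ z) :=
    measurable_uncurry_of_continuous_of_measurable
      (fun z => continuousOn_iff_continuous_domRestrict.1 (hcont z)) fun θ => hmeas θ θ.2
  exact h.comp ((hθ.subtype_mk (h := hθK)).prodMk hz)

section Scores

variable {𝒵 : Type*} [MeasurableSpace 𝒵] {d : ℕ} {K : Set (E d)} {loss : E d → 𝒵 → ℝ}
  {s : 𝒵 → E d → ℝ} {h : SGDParams d}

lemma measurable_sgdIter (hne : K.Nonempty) (hcl : IsClosed K) (hcv : Convex ℝ K) (hC : 0 < h.C)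
    (h0 : h.θ₀ ∈ K) (hgcont : ∀ z, ContinuousOn (fun θ => gradient (fun w => loss w z) θ) K)
    (hgmeas : ∀ θ ∈ K, Measurable fun z => gradient (fun w => loss w z) θ) {m : ℕ} (t : ℕ) :
    Measurable fun x : ((Fin m → 𝒵) × (ℕ → Fin m → Bool)) × (ℕ → E d) =>
      sgdIter K loss h x.1.1 x.1.2 x.2 t := by
  induction t with
  | zero => exact measurable_const
  | succ t ih =>
    have hmask : Measurable fun x : ((Fin m → 𝒵) × (ℕ → Fin m → Bool)) × (ℕ → E d) => x.1.2 t := by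
      fun_prop
    have hgrad : ∀ i, Measurable fun x : ((Fin m → 𝒵) × (ℕ → Fin m → Bool)) × (ℕ → E d) =>
        clip h.C (gradient (fun w => loss w (x.1.1 i)) (sgdIter K loss h x.1.1 x.1.2 x.2 t)) :=
      fun i => (continuous_clip hC).measurable.comp <|
        measurable_comp_of_continuousOn (f := fun θ z => gradient (fun w => loss w z) θ)
          hgcont hgmeas ih (fun x => sgdIter_mem hne hcl hcv h0 _ _ _ t) (by fun_prop)
    have hsum : Measurable fun x : ((Fin m → 𝒵) × (ℕ → Fin m → Bool)) × (ℕ → E d) =>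
        ∑ i ∈ batch (x.1.2 t), clip h.C (gradient (fun w => loss w (x.1.1 i))
          (sgdIter K loss h x.1.1 x.1.2 x.2 t)) := by
      simp only [batch, Finset.sum_filter]
      refine Finset.measurable_sum _ fun i _ => Measurable.ite ?_ (hgrad i) measurable_const
      exact (measurable_pi_apply i).comp hmask (measurableSet_singleton true)
    have hcard : Measurable fun x : ((Fin m → 𝒵) × (ℕ → Fin m → Bool)) × (ℕ → E d) =>
        ((batch (x.1.2 t)).card : ℝ)⁻¹ :=
      (measurable_of_countable fun b : Fin m → Bool => ((batch b).card : ℝ)⁻¹).comp hmask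
    have hempty : MeasurableSet {x : ((Fin m → 𝒵) × (ℕ → Fin m → Bool)) × (ℕ → E d) |
        batch (x.1.2 t) = ∅} := hmask (Set.toFinite {b | batch b = ∅}).measurableSet
    refine Measurable.ite hempty ih ((continuous_proj hne hcl hcv).measurable.comp ?_)
    have hξ : Measurable fun x : ((Fin m → 𝒵) × (ℕ → Fin m → Bool)) × (ℕ → E d) => h.σ • x.2 t := by
      fun_prop
    exact ih.sub ((hcard.smul (hsum.add hξ)).const_smul h.η)

lemma measurable_idealScore (hne : K.Nonempty) (hcl : IsClosed K) (hcv : Convex ℝ K)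
    (hC : 0 < h.C) (h0 : h.θ₀ ∈ K)
    (hgcont : ∀ z, ContinuousOn (fun θ => gradient (fun w => loss w z) θ) K)
    (hgmeas : ∀ θ ∈ K, Measurable fun z => gradient (fun w => loss w z) θ)
    (hscont : ∀ z, ContinuousOn (s z) K) (hsmeas : ∀ θ ∈ K, Measurable fun z => s z θ) {n : ℕ}
    (i : Fin (n + 1)) :
    Measurable (idealScore K loss s h i : Sample 𝒵 d n → ℝ) := by
  have hθ : Measurable (thetaIdeal K loss h : Sample 𝒵 d n → E d) :=
    (measurable_sgdIter hne hcl hcv hC h0 hgcont hgmeas h.T).comp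
      (g := fun x : ((Fin (n + 1) → 𝒵) × (ℕ → Fin (n + 1) → Bool)) × (ℕ → E d) =>
        sgdIter K loss h x.1.1 x.1.2 x.2 h.T)
      (f := fun ω : Sample 𝒵 d n => (ω.1, ω.2.1)) (by fun_prop)
  exact measurable_comp_of_continuousOn (f := fun θ z => s z θ) hscont hsmeas hθ
    (fun ω => sgdIter_mem hne hcl hcv h0 _ _ _ _) (by fun_prop)

lemma measurable_orderStat {Ω : Type*} [MeasurableSpace Ω] {m k : ℕ} (hk : 1 ≤ k) (hkm : k ≤ m)
    {S : Fin m → Ω → ℝ} (hS : ∀ i, Measurable (S i)) :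
    Measurable fun ω => orderStat (fun i => S i ω) k := by
  refine measurable_of_Iic fun t => ?_
  have hcount : Measurable fun ω => count (fun i => S i ω) t := by
    simp only [count, Finset.card_filter]
    exact Finset.measurable_sum _ fun i _ =>
      Measurable.ite (hS i measurableSet_Iic) measurable_const measurable_const
  have : (fun ω => orderStat (fun i => S i ω) k) ⁻¹' Set.Iic t =
      {ω | k ≤ count (fun i => S i ω) t} := by
    ext ω
    exact orderStat_le_iff hk hkm
  rw [this]
  exact hcount measurableSet_Ici

/-- Simultaneous reindexing of the data points and of their inclusion indicators. -/
noncomputable def permuteSample (𝒵 : Type*) [MeasurableSpace 𝒵] (d : ℕ) {n : ℕ}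
    (e : Equiv.Perm (Fin (n + 1))) : Sample 𝒵 d n ≃ᵐ Sample 𝒵 d n :=
  ((permute e 𝒵).prodCongr (MeasurableEquiv.piCongrRight fun _ => permute e Bool)).prodCongr
    (MeasurableEquiv.refl _)

lemma measurePreserving_permuteSample (P : Measure 𝒵) [IsProbabilityMeasure P] {n : ℕ}
    (q : unitInterval) (e : Equiv.Perm (Fin (n + 1))) :
    MeasurePreserving (permuteSample 𝒵 d e) (sampleMeasure P d n q) (sampleMeasure P d n q) := by
  have hmask : MeasurePreserving (fun (b : ℕ → Fin (n + 1) → Bool) t => permute e Bool (b t))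
      (Measure.infinitePi fun _ : ℕ => maskMeasure (n + 1) q)
      (Measure.infinitePi fun _ : ℕ => maskMeasure (n + 1) q) := by
    refine ⟨by fun_prop, ?_⟩
    rw [Measure.infinitePi_map_pi (f := fun _ => permute e Bool) _
      fun _ => (permute e Bool).measurable]
    simp only [(measurePreserving_permute e (bernoulliMeasure true false q)).map_eq]
  exact ((measurePreserving_permute e P).prod hmask).prod (MeasurePreserving.id _)

/-- Each update sees the data only through the size of the minibatch and a sum over it, both
unchanged when points and indicators are reindexed together. -/
lemma thetaIdeal_permuteSample {n : ℕ} (e : Equiv.Perm (Fin (n + 1))) (ω : Sample 𝒵 d n) :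
    thetaIdeal K loss h (permuteSample 𝒵 d e ω) = thetaIdeal K loss h ω := by
  have hstep : ∀ (z : Fin (n + 1) → 𝒵) (b : Fin (n + 1) → Bool) (ξ θ : E d),
      sgdStep K loss h (permute e 𝒵 z) (permute e Bool b) ξ θ = sgdStep K loss h z b ξ θ := by
    intro z b ξ θ
    have hcard := card_batch_permute e b
    by_cases hb : batch b = ∅
    · rw [sgdStep_of_batch_eq_empty hb, sgdStep_of_batch_eq_empty]
      rw [← Finset.card_eq_zero, hcard, hb, Finset.card_empty]
    · rw [sgdStep_of_batch_ne_empty hb, sgdStep_of_batch_ne_empty, hcard, sum_batch_permute]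
      · simp only [permute_apply]
      · rwa [Ne, ← Finset.card_eq_zero, hcard, Finset.card_eq_zero]
  change sgdIter K loss h (permute e 𝒵 ω.1.1) (fun t => permute e Bool (ω.1.2 t)) ω.2.1 h.T = _
  rw [thetaIdeal]
  generalize h.T = t
  induction t with
  | zero => rfl
  | succ t ih => rw [sgdIter, sgdIter, ih, hstep]

lemma idealScore_permuteSample {n : ℕ} (e : Equiv.Perm (Fin (n + 1))) (i : Fin (n + 1))
    (ω : Sample 𝒵 d n) :
    idealScore K loss s h (e i) (permuteSample 𝒵 d e ω) = idealScore K loss s h i ω := by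
  rw [idealScore, idealScore, thetaIdeal_permuteSample]
  exact congrArg (fun z => s z (thetaIdeal K loss h ω)) (permute_apply e ω.1.1 i)

lemma qStar_permuteSample {n : ℕ} (α : ℝ) (e : Equiv.Perm (Fin (n + 1))) (ω : Sample 𝒵 d n) :
    qStar K loss s h α (permuteSample 𝒵 d e ω) = qStar K loss s h α ω := by
  rw [qStar, qStar, ← orderStat_comp_perm e]
  congr 1
  funext i
  exact idealScore_permuteSample e i ω

end Scores

lemma integral_card_filter_mem {Ω ι : Type*} [MeasurableSpace Ω] (μ : Measure Ω)
    [IsFiniteMeasure μ] [Fintype ι] (p : ι → Ω → Prop) [∀ i ω, Decidable (p i ω)]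
    (hp : ∀ i, MeasurableSet {ω | p i ω}) :
    Integrable (fun ω => ((Finset.univ.filter fun i => p i ω).card : ℝ)) μ ∧
      ∫ ω, ((Finset.univ.filter fun i => p i ω).card : ℝ) ∂μ = ∑ i, μ.real {ω | p i ω} := by
  have heq : (fun ω => ((Finset.univ.filter fun i => p i ω).card : ℝ)) =
      fun ω => ∑ i, Set.indicator {ω | p i ω} (fun _ => (1 : ℝ)) ω := by
    funext ω
    rw [Finset.card_filter]
    push_cast
    simp only [Set.indicator_apply, Set.mem_ofPred_eq]
  have hint : ∀ i, Integrable (Set.indicator {ω | p i ω} fun _ => (1 : ℝ)) μ := fun i =>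
    (integrable_const _).indicator (hp i)
  rw [heq]
  refine ⟨integrable_finsetSum _ fun i _ => hint i, ?_⟩
  rw [integral_finsetSum _ fun i _ => hint i]
  simp [integral_indicator_const _ (hp _)]

/-! ### The target rank -/

lemma one_le_targetRank {α : ℝ} (hα1 : α < 1) (n : ℕ) : 1 ≤ targetRank α n :=
  Nat.ceil_pos.2 (mul_pos (by linarith) (by positivity))

lemma le_targetRank (α : ℝ) (n : ℕ) : (1 - α) * ((n : ℝ) + 1) ≤ targetRank α n := Nat.le_ceil _

/-! ### Coverage -/

section Coverage

variable {𝒵 : Type*} [MeasurableSpace 𝒵] {P : Measure 𝒵} [IsProbabilityMeasure P] {d n : ℕ}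
  {K : Set (E d)} {loss : E d → 𝒵 → ℝ} {s : 𝒵 → E d → ℝ} {h : SGDParams d} {α : ℝ}

omit [IsProbabilityMeasure P] in
lemma ae_injective_idealScore (hties : NoTies P K loss s h n) :
    ∀ᵐ ω ∂(sampleMeasure P d n h.q), Function.Injective fun i => idealScore K loss s h i ω := by
  have : ∀ᵐ ω ∂(sampleMeasure P d n h.q), ∀ i j : Fin (n + 1), i ≠ j →
      idealScore K loss s h i ω ≠ idealScore K loss s h j ω := by
    simp only [ae_all_iff]
    intro i j hij
    simpa [ae_iff] using hties i j hij
  filter_upwards [this] with ω hω i j hij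
  by_contra hne
  exact hω i j hne hij

/-- By exchangeability, the last ideal score is at least the `r`-th order statistic with
probability at most `1 - (r - 1) / (n + 1)`. -/
lemma measureReal_qStar_le_idealScore_le (hα1 : α < 1) (hrn : targetRank α n ≤ n + 1)
    (hmeas : ∀ i, Measurable (idealScore K loss s h i : Sample 𝒵 d n → ℝ))
    (hties : NoTies P K loss s h n) :
    (sampleMeasure P d n h.q).real
      {ω | qStar K loss s h α ω ≤ idealScore K loss s h (Fin.last n) ω} ≤
      α + 1 / ((n : ℝ) + 1) := by
  set μ := sampleMeasure P d n h.q
  have hr := one_le_targetRank hα1 n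
  have hq : Measurable (qStar K loss s h α : Sample 𝒵 d n → ℝ) := measurable_orderStat hr hrn hmeas
  have hsymm : ∀ i, μ.real {ω | qStar K loss s h α ω ≤ idealScore K loss s h i ω} =
      μ.real {ω | qStar K loss s h α ω ≤ idealScore K loss s h (Fin.last n) ω} := fun i => by
    rw [measureReal_def, measureReal_def, ← (measurePreserving_permuteSample P h.q
      (Equiv.swap i (Fin.last n))).measure_preimage_equiv {ω | qStar K loss s h α ω ≤
        idealScore K loss s h (Fin.last n) ω}]
    congr 2
    ext ω
    have h1 := idealScore_permuteSample (K := K) (loss := loss) (s := s) (h := h)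
      (Equiv.swap i (Fin.last n)) i ω
    rw [Equiv.swap_apply_left] at h1
    rw [Set.mem_preimage, Set.mem_ofPred_eq, Set.mem_ofPred_eq, qStar_permuteSample, h1]
  obtain ⟨hint, hsum⟩ := integral_card_filter_mem μ
    (fun i ω => qStar K loss s h α ω ≤ idealScore K loss s h i ω)
    fun i => measurableSet_le hq (hmeas i)
  rw [Finset.sum_congr rfl fun i _ => hsymm i] at hsum
  -- Without ties at least `r - 1` scores lie strictly below `q_*`, so at most `n + 1 - (r - 1)` are
  -- `≥ q_*`; by symmetry the expected number is `n + 1` times the wanted probability.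
  have hle : ∫ ω, ((Finset.univ.filter fun i =>
      qStar K loss s h α ω ≤ idealScore K loss s h i ω).card : ℝ) ∂μ ≤
      ∫ _, ((n : ℝ) + 2 - targetRank α n) ∂μ := by
    refine integral_mono_ae hint (integrable_const _) ?_
    filter_upwards [ae_injective_idealScore hties] with ω hω
    have h1 := le_card_lt_orderStat_add_one hω hr hrn
    have h2 := Finset.card_filter_add_card_filter_not (s := (Finset.univ : Finset (Fin (n + 1))))
      (fun i => idealScore K loss s h i ω < qStar K loss s h α ω)
    simp only [not_lt, Finset.card_univ, Fintype.card_fin] at h2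
    have h3 : (targetRank α n : ℝ) ≤ ((Finset.univ.filter fun i =>
        idealScore K loss s h i ω < qStar K loss s h α ω).card : ℝ) + 1 := by exact_mod_cast h1
    have h4 : ((Finset.univ.filter fun i =>
        idealScore K loss s h i ω < qStar K loss s h α ω).card : ℝ) + ((Finset.univ.filter fun i =>
        qStar K loss s h α ω ≤ idealScore K loss s h i ω).card : ℝ) = n + 1 := by exact_mod_cast h2
    linarith
  rw [hsum] at hle
  simp only [Finset.sum_const, Finset.card_univ, Fintype.card_fin, nsmul_eq_mul, integral_const,
    probReal_univ, one_smul] at hle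
  push_cast at hle
  have hn : (0 : ℝ) < (n : ℝ) + 1 := by positivity
  rw [← mul_le_mul_iff_right₀ hn]
  have h5 := le_targetRank α n
  calc _ ≤ (n : ℝ) + 2 - targetRank α n := hle
    _ ≤ (n : ℝ) + 2 - (1 - α) * ((n : ℝ) + 1) := by linarith
    _ = ((n : ℝ) + 1) * (α + 1 / ((n : ℝ) + 1)) := by field_simp; ring

/-- By Markov's inequality, more than `buf` ideal scores just above `q_*` are unlikely. -/
lemma measureReal_band_le (hα1 : α < 1) (hrn : targetRank α n ≤ n + 1)
    (hmeas : ∀ i, Measurable (idealScore K loss s h i : Sample 𝒵 d n → ℝ)) {ε c δ : ℝ}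
    (hδ : 0 < δ) {buf : ℕ} (hbuf : n * c ≤ buf * δ)
    (hc : ∀ i : Fin n, (sampleMeasure P d n h.q).real
      {ω | qStar K loss s h α ω < idealScore K loss s h i.castSucc ω ∧
        idealScore K loss s h i.castSucc ω ≤ qStar K loss s h α ω + ε} ≤ c) :
    (sampleMeasure P d n h.q).real
      {ω | buf < (Finset.univ.filter fun i : Fin n =>
        qStar K loss s h α ω < idealScore K loss s h i.castSucc ω ∧
        idealScore K loss s h i.castSucc ω ≤ qStar K loss s h α ω + ε).card} ≤ δ := by
  set μ := sampleMeasure P d n h.q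
  have hq : Measurable (qStar K loss s h α : Sample 𝒵 d n → ℝ) :=
    measurable_orderStat (one_le_targetRank hα1 n) hrn hmeas
  obtain ⟨hint, hsum⟩ := integral_card_filter_mem μ
    (fun (i : Fin n) ω => qStar K loss s h α ω < idealScore K loss s h i.castSucc ω ∧
        idealScore K loss s h i.castSucc ω ≤ qStar K loss s h α ω + ε)
    fun i => (measurableSet_lt hq (hmeas _)).inter (measurableSet_le (hmeas _) (hq.add_const ε))
  -- An integer count exceeding `buf` is at least `buf + 1`, which is positive even for a zero
  -- buffer.
  have hmarkov := mul_meas_ge_le_integral_of_nonneg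
    (Eventually.of_forall fun ω => Nat.cast_nonneg _) hint ((buf : ℝ) + 1)
  rw [hsum] at hmarkov
  have hle := hmarkov.trans (Finset.sum_le_card_nsmul _ _ c fun i _ => hc i)
  rw [Finset.card_univ, Fintype.card_fin, nsmul_eq_mul] at hle
  have hpos : (0 : ℝ) < (buf : ℝ) + 1 := by positivity
  have hset : {ω | buf < (Finset.univ.filter fun i : Fin n =>
        qStar K loss s h α ω < idealScore K loss s h i.castSucc ω ∧
        idealScore K loss s h i.castSucc ω ≤ qStar K loss s h α ω + ε).card} =
      {ω | (buf : ℝ) + 1 ≤ ((Finset.univ.filter fun i : Fin n =>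
        qStar K loss s h α ω < idealScore K loss s h i.castSucc ω ∧
        idealScore K loss s h i.castSucc ω ≤ qStar K loss s h α ω + ε).card : ℝ)} := by
    ext ω
    rw [Set.mem_ofPred_eq, Set.mem_ofPred_eq, ← Nat.succ_le_iff]
    exact_mod_cast Iff.rfl
  rw [hset, ← mul_le_mul_iff_right₀ hpos]
  linarith

omit [IsProbabilityMeasure P] in
lemma AntiConcentrated.nonneg {fbar ρ : ℝ} (hρ : 0 < ρ)
    (hanti : AntiConcentrated P K loss s h α n fbar ρ) : 0 ≤ fbar := by
  have := measureReal_nonneg.trans (hanti ρ hρ le_rfl 0).1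
  exact nonneg_of_mul_nonneg_left this hρ

omit [IsProbabilityMeasure P] in
lemma AntiConcentrated.of_nonneg {fbar ρ ε : ℝ}
    (hanti : AntiConcentrated P K loss s h α n fbar ρ) (hε0 : 0 ≤ ε) (hε : ε ≤ ρ)
    (i : Fin (n + 1)) :
    (sampleMeasure P d n h.q).real
      {ω | qStar K loss s h α ω < idealScore K loss s h i ω ∧
        idealScore K loss s h i ω ≤ qStar K loss s h α ω + ε} ≤ fbar * ε ∧
    (sampleMeasure P d n h.q).real
      {ω | qStar K loss s h α ω - ε ≤ idealScore K loss s h i ω ∧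
        idealScore K loss s h i ω < qStar K loss s h α ω} ≤ fbar * ε := by
  -- A zero width occurs when the score has Lipschitz constant `0`; both bands are then empty.
  rcases hε0.eq_or_lt with rfl | hpos
  · have h1 : {ω : Sample 𝒵 d n | qStar K loss s h α ω < idealScore K loss s h i ω ∧
        idealScore K loss s h i ω ≤ qStar K loss s h α ω + 0} = ∅ :=
      Set.eq_empty_of_forall_notMem fun ω hω => by linarith [hω.1, hω.2]
    have h2 : {ω : Sample 𝒵 d n | qStar K loss s h α ω - 0 ≤ idealScore K loss s h i ω ∧
        idealScore K loss s h i ω < qStar K loss s h α ω} = ∅ :=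
      Set.eq_empty_of_forall_notMem fun ω hω => by linarith [hω.1, hω.2]
    rw [h1, h2]
    simp
  · exact hanti ε hpos hε i

/-- Union bound over six failures: instability, ties, a range that is too short, an overfull band
above `q_*`, a test score at or above `q_*`, and a test score just below `q_*`. Outside them, low
search noise forces coverage. -/
lemma le_qHat_probability (hne : K.Nonempty) (hcl : IsClosed K) (hcv : Convex ℝ K)
    (h0 : h.θ₀ ∈ K) {Ls : ℝ} (hLs : 0 ≤ Ls)
    (hLip : ∀ z, ∀ θ ∈ K, ∀ θ' ∈ K, |s z θ - s z θ'| ≤ Ls * ‖θ - θ'‖) (hα1 : α < 1)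
    (hmeas : ∀ i, Measurable (idealScore K loss s h i : Sample 𝒵 d n → ℝ))
    (hties : NoTies P K loss s h n) {fbar ρ : ℝ} (hρ : 0 < ρ)
    (hanti : AntiConcentrated P K loss s h α n fbar ρ) {σQ β : ℝ} (hσQ : 0 < σQ) (hβ0 : 0 < β)
    (hβ1 : β < 1) (N : ℕ) (a b : (Fin n → ℝ) → ℝ)
    (hrange : ∀ᵐ ω ∂(sampleMeasure P d n h.q), ∀ i : Fin n,
      actualScore K loss s h i.castSucc ω ≤ b fun j => actualScore K loss s h j.castSucc ω)
    {u δ : ℝ} (hu : 0 < u) (hδ : 0 < δ) (hstable : ModelStable P K loss h n u δ)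
    (huρ : Ls * u ≤ ρ) (hrank : targetRank α n + buffer fbar Ls u δ n ≤ n) :
    coverageBound α β fbar Ls u δ n ≤ (sampleMeasure P d n h.q).real
      {ω | actualScore K loss s h (Fin.last n) ω ≤
        qHat K loss s h a b α (buffer fbar Ls u δ n) N σQ β ω} := by
  set μ := sampleMeasure P d n h.q
  set m := buffer fbar Ls u δ n with hm
  set ε := Ls * u with hε
  have hε0 : 0 ≤ ε := by positivity
  have hfbar := hanti.nonneg hρ
  have hr := one_le_targetRank hα1 n
  have hrn : targetRank α n ≤ n + 1 := by omega
  have hbuf : n * (fbar * ε) ≤ m * δ := by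
    rw [← div_le_iff₀ hδ]
    refine le_trans (le_of_eq ?_) (Nat.le_ceil _)
    rw [hε]; ring
  set bad₁ : Set (Sample 𝒵 d n) := {ω | u < ‖thetaIdeal K loss h ω - thetaActual K loss h ω‖}
  set bad₂ : Set (Sample 𝒵 d n) :=
    {ω | ¬ Function.Injective fun i => idealScore K loss s h i ω}
  set bad₃ : Set (Sample 𝒵 d n) := {ω | ¬ ∀ i : Fin n, actualScore K loss s h i.castSucc ω ≤
    b fun j => actualScore K loss s h j.castSucc ω}
  set bad₄ : Set (Sample 𝒵 d n) := {ω | m < (Finset.univ.filter fun i : Fin n =>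
        qStar K loss s h α ω < idealScore K loss s h i.castSucc ω ∧
        idealScore K loss s h i.castSucc ω ≤ qStar K loss s h α ω + ε).card}
  set bad₅ : Set (Sample 𝒵 d n) :=
    {ω | qStar K loss s h α ω ≤ idealScore K loss s h (Fin.last n) ω}
  set bad₆ : Set (Sample 𝒵 d n) :=
    {ω | qStar K loss s h α ω - ε ≤ idealScore K loss s h (Fin.last n) ω ∧
        idealScore K loss s h (Fin.last n) ω < qStar K loss s h α ω}
  set good := (bad₁ ∪ bad₂ ∪ bad₃ ∪ bad₄ ∪ bad₅ ∪ bad₆)ᶜ with hgood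
  have hcover : good ∩ {ω | ω.2.2 ∈ {ζ | ∀ k < N, ζ k < normalQuantile (1 - β / N)}} ⊆
      {ω | actualScore K loss s h (Fin.last n) ω ≤ qHat K loss s h a b α m N σQ β ω} := by
    rintro ω ⟨hω, hζ⟩
    simp only [hgood, Set.compl_union, Set.mem_inter_iff, Set.mem_compl_iff] at hω
    obtain ⟨⟨⟨⟨⟨h1, h2⟩, h3⟩, h4⟩, h5⟩, h6⟩ := hω
    simp only [bad₁, bad₂, bad₃, bad₄, bad₅, bad₆, Set.mem_ofPred_eq, not_not, not_lt, not_le,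
      not_and] at h1 h2 h3 h4 h5 h6
    refine le_threshold_of_count (S := fun i => idealScore K loss s h i ω)
      (S' := fun i => actualScore K loss s h i ω) h2 hr hrn (fun i => ?_) ?_ h4 ?_
    · refine (hLip _ _ (sgdIter_mem hne hcl hcv h0 _ _ _ _) _
        (sgdIter_mem hne hcl hcv h0 _ _ _ _)).trans ?_
      exact mul_le_mul_of_nonneg_left h1 hLs
    · by_contra! hlow
      exact (h6 hlow).not_gt h5
    -- The invariant holds initially since the upper end `b` dominates all `n` actual scores and `r
    -- + m ≤ n`.
    · refine count_searchBracket (R := targetRank α n + m) hσQ (by push_cast; rfl) ?_ N hζ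
      rw [count, Finset.filter_true_of_mem fun i _ => h3 i]
      simpa using hrank
  have hgoodprob : 1 - α - 2 * fbar * Ls * u - 3 * δ - 1 / ((n : ℝ) + 1) ≤ μ.real good := by
    have b1 : μ.real bad₁ ≤ δ := hstable
    have b2 : μ.real bad₂ = 0 := by
      rw [measureReal_def, ae_iff.1 (ae_injective_idealScore hties), ENNReal.toReal_zero]
    have b3 : μ.real bad₃ = 0 := by
      rw [measureReal_def, ae_iff.1 hrange, ENNReal.toReal_zero]
    have b4 : μ.real bad₄ ≤ δ := measureReal_band_le hα1 hrn hmeas hδ hbuf fun i =>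
      (hanti.of_nonneg hε0 huρ i.castSucc).1
    have b5 : μ.real bad₅ ≤ α + 1 / ((n : ℝ) + 1) :=
      measureReal_qStar_le_idealScore_le hα1 hrn hmeas hties
    have b6 : μ.real bad₆ ≤ fbar * ε := (hanti.of_nonneg hε0 huρ (Fin.last n)).2
    have hunion : (1 : ℝ) ≤ μ.real good + (μ.real bad₁ + μ.real bad₂ + μ.real bad₃ + μ.real bad₄ +
        μ.real bad₅ + μ.real bad₆) := by
      have : 1 ≤ μ.real good + μ.real goodᶜ := by
        simpa [Set.union_compl_self] using measureReal_union_le (μ := μ) good goodᶜ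
      refine this.trans ?_
      rw [hgood, compl_compl]
      gcongr
      exact (measureReal_union_le _ _).trans <| add_le_add_left ((measureReal_union_le _ _).trans <|
        add_le_add_left ((measureReal_union_le _ _).trans <| add_le_add_left
        ((measureReal_union_le _ _).trans <| add_le_add_left (measureReal_union_le _ _) _) _) _) _
    -- The failures total at most `α + 1 / (n + 1) + f̄ ε + 2 δ`; the stated bound gives away a
    -- further `f̄ ε + δ`.
    have hfe : 0 ≤ fbar * ε := by positivity
    have : 2 * fbar * Ls * u = 2 * (fbar * ε) := by rw [hε]; ring
    linarith
  calc coverageBound α β fbar Ls u δ n ≤ (1 - β) * μ.real good :=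
        mul_le_mul_of_nonneg_left hgoodprob (by linarith)
    _ ≤ noiseMeasure.real {ζ | ∀ k < N, ζ k < normalQuantile (1 - β / N)} * μ.real good :=
        mul_le_mul_of_nonneg_right (one_sub_le_noiseMeasure hβ0 hβ1 N) measureReal_nonneg
    _ = μ.real (good ∩ {ω | ω.2.2 ∈ {ζ | ∀ k < N, ζ k < normalQuantile (1 - β / N)}}) := by
        rw [mul_comm]
        exact (sampleMeasure_real_inter_noise P d n h.q good (fun ω hω ζ => hω) _).symm
    _ ≤ _ := measureReal_mono hcover

end Coverage

/-! ### Asymptotics -/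

section Asymptotics

variable {d : ℕ} {h : ℕ → SGDParams d} {Lg : ℝ}

lemma stabilityRate_nonneg {h : SGDParams d} (hLg : 0 < Lg) (hη : 0 ≤ h.η) (hC : 0 < h.C)
    (hσ : 0 ≤ h.σ) (n : ℕ) : 0 ≤ stabilityRate Lg h n := by
  have h1 : (1 - (h.q : ℝ)) ^ (n + 1) ≤ 1 :=
    pow_le_one₀ (sub_nonneg.2 h.q.2.2) (by linarith [h.q.2.1])
  have h2 : 1 ≤ Real.exp (h.η * Lg * h.T) := Real.one_le_exp (by positivity)
  exact mul_nonneg (mul_nonneg (div_nonneg (by linarith) (by positivity)) (by positivity))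
    (by linarith)

/-- The probability of a nonempty minibatch is at most `1` for any `q`, so the first factor is
`O(1/n)`; the exponential is bounded because `η T = O(1)`. -/
lemma stabilityRate_isBigO (hLg : 0 < Lg) (hη : ∀ n, 0 ≤ (h n).η)
    (hηO : (fun n => (h n).η) =O[atTop] fun n : ℕ => 1 / (n : ℝ))
    (hTO : (fun n => ((h n).T : ℝ)) =O[atTop] fun n : ℕ => (n : ℝ))
    (hCσO : (fun n => 2 * (h n).C + (h n).σ * √(d : ℝ)) =O[atTop] fun _ : ℕ => (1 : ℝ)) :
    (fun n => stabilityRate Lg (h n) n) =O[atTop] fun n : ℕ => (n : ℝ)⁻¹ := by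
  have h1 : (fun n => (1 - (1 - ((h n).q : ℝ)) ^ (n + 1)) / (((n : ℝ) + 1) * Lg)) =O[atTop]
      fun n : ℕ => (n : ℝ)⁻¹ := by
    refine IsBigO.of_bound Lg⁻¹ ?_
    filter_upwards [eventually_gt_atTop 0] with n hn
    have hn' : (0 : ℝ) < n := by exact_mod_cast hn
    have hq0 : 0 ≤ 1 - ((h n).q : ℝ) := sub_nonneg.2 (h n).q.2.2
    have hq1 : (1 - ((h n).q : ℝ)) ^ (n + 1) ≤ 1 := pow_le_one₀ hq0 (by linarith [(h n).q.2.1])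
    have hq2 : 0 ≤ (1 - ((h n).q : ℝ)) ^ (n + 1) := pow_nonneg hq0 _
    rw [Real.norm_of_nonneg (div_nonneg (by linarith) (by positivity)),
      Real.norm_of_nonneg (by positivity), ← mul_inv, ← one_div]
    apply div_le_div₀ zero_le_one (by linarith) (by positivity)
    nlinarith
  have h2 : (fun n => (h n).η * Lg * (h n).T) =O[atTop] fun _ : ℕ => (1 : ℝ) := by
    refine ((hηO.mul hTO).const_mul_left Lg).congr' (Eventually.of_forall fun n => by ring) ?_
    filter_upwards [eventually_gt_atTop 0] with n hn
    have hn' : (n : ℝ) ≠ 0 := by exact_mod_cast hn.ne'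
    exact one_div_mul_cancel hn'
  have h3 : (fun n => Real.exp ((h n).η * Lg * (h n).T) - 1) =O[atTop]
      fun _ : ℕ => (1 : ℝ) := by
    obtain ⟨c, hc⟩ := h2.bound
    refine IsBigO.of_bound (Real.exp c) ?_
    filter_upwards [hc] with n hn
    have hx0 : 0 ≤ (h n).η * Lg * (h n).T := by have := hη n; positivity
    rw [norm_one, mul_one, Real.norm_of_nonneg hx0] at hn
    have h4 := Real.one_le_exp hx0
    have h5 := Real.exp_le_exp.2 hn
    rw [norm_one, mul_one, Real.norm_of_nonneg (by linarith)]
    linarith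
  simpa [stabilityRate] using (h1.mul hCσO).mul h3

lemma natCast_rpow_isLittleO {r : ℝ} (hr : r < 1) :
    (fun n : ℕ => (n : ℝ) ^ r) =o[atTop] fun n : ℕ => (n : ℝ) := by
  refine (isLittleO_iff_tendsto' ?_).2 <| ((tendsto_rpow_neg_atTop (sub_pos.2 hr)).comp
    tendsto_natCast_atTop_atTop).congr' ?_
  · filter_upwards [eventually_gt_atTop 0] with n hn h0
    exact absurd h0 (by exact_mod_cast hn.ne')
  · filter_upwards [eventually_gt_atTop 0] with n hn
    have hn' : (0 : ℝ) < n := by exact_mod_cast hn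
    rw [Function.comp, neg_sub, Real.rpow_sub hn', Real.rpow_one]

lemma buffer_isBigO {e u δ : ℕ → ℝ} {fbar Ls : ℝ} (he : ∀ n, 0 ≤ e n)
    (heO : e =O[atTop] fun n : ℕ => (n : ℝ)⁻¹)
    (hu : u =Θ[atTop] fun n => e n ^ (2 / 3 : ℝ)) (hδ : δ =Θ[atTop] fun n => e n ^ (1 / 3 : ℝ)) :
    (fun n => (buffer fbar Ls (u n) (δ n) n : ℝ)) =O[atTop] fun n : ℕ => (n : ℝ) ^ (2 / 3 : ℝ) := by
  have h1 : (fun n => u n / δ n) =O[atTop] fun n => e n ^ (1 / 3 : ℝ) := by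
    refine (hu.div hδ).isBigO.congr_right fun n => ?_
    -- The rate may vanish, for instance when `T = 0`; then `0 / 0 = 0` agrees with `0 ^ (1/3)`.
    rcases (he n).eq_or_lt with h0 | hpos
    · rw [← h0, Real.zero_rpow (by norm_num), Real.zero_rpow (by norm_num), zero_div]
    · rw [← Real.rpow_sub hpos]; norm_num
  have h2 : (fun n => e n ^ (1 / 3 : ℝ)) =O[atTop] fun n : ℕ => ((n : ℝ)⁻¹) ^ (1 / 3 : ℝ) :=
    heO.rpow (by norm_num) (Eventually.of_forall fun n => by positivity)
  have h3 : (fun n : ℕ => (n : ℝ) * fbar * Ls * u n / δ n) =O[atTop]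
      fun n : ℕ => (n : ℝ) ^ (2 / 3 : ℝ) := by
    refine (((isBigO_refl (fun n : ℕ => (n : ℝ)) atTop).mul (h1.trans h2)).const_mul_left
      (fbar * Ls)).congr' (Eventually.of_forall fun n => by ring) ?_
    filter_upwards [eventually_gt_atTop 0] with n hn
    have hn' : (0 : ℝ) < n := by exact_mod_cast hn
    rw [Real.inv_rpow hn'.le, ← Real.rpow_neg hn'.le]
    nth_rewrite 1 [← Real.rpow_one (n : ℝ)]
    rw [← Real.rpow_add hn']
    norm_num
  have h4 : (fun _ : ℕ => (1 : ℝ)) =O[atTop] fun n : ℕ => (n : ℝ) ^ (2 / 3 : ℝ) := by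
    refine IsBigO.of_bound 1 ?_
    filter_upwards [eventually_ge_atTop 1] with n hn
    have hn' : (1 : ℝ) ≤ n := by exact_mod_cast hn
    have := Real.one_le_rpow hn' (by norm_num : (0 : ℝ) ≤ 2 / 3)
    rw [one_mul, norm_one]
    exact this.trans (le_abs_self _)
  refine IsBigO.trans (IsBigO.of_bound 1 (Eventually.of_forall fun n => ?_)) (h3.norm_left.add h4)
  rw [one_mul, Real.norm_natCast, Real.norm_of_nonneg (by positivity), buffer]
  rcases le_or_gt ((n : ℝ) * fbar * Ls * u n / δ n) 0 with hx | hx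
  · rw [Nat.ceil_eq_zero.2 hx, Nat.cast_zero]
    positivity
  · exact (Nat.ceil_lt_add_one hx.le).le.trans (by gcongr; exact le_abs_self _)

lemma eventually_targetRank_add_le {α : ℝ} (hα0 : 0 < α) (hα1 : α < 1) {m : ℕ → ℕ}
    (hm : (fun n => (m n : ℝ)) =o[atTop] fun n : ℕ => (n : ℝ)) :
    ∀ᶠ n in atTop, targetRank α n + m n ≤ n := by
  filter_upwards [hm.bound (half_pos hα0),
    -- Since `r < (1 - α)(n + 1) + 1` and eventually `m ≤ (α / 2) n`, the sum is at most `n` once `2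
    -- - α ≤ (α / 2) n`.
    tendsto_natCast_atTop_atTop.eventually_ge_atTop ((2 - α) / (α / 2))] with n h1 h2
  rw [Real.norm_natCast, Real.norm_natCast] at h1
  rw [div_le_iff₀ (half_pos hα0)] at h2
  have h3 : (targetRank α n : ℝ) < (1 - α) * ((n : ℝ) + 1) + 1 :=
    Nat.ceil_lt_add_one (mul_nonneg (by linarith) (by positivity))
  have h4 : ((targetRank α n + m n : ℕ) : ℝ) ≤ n := by push_cast; linarith
  exact_mod_cast h4

lemma tendsto_coverageBound {α fbar Ls : ℝ} {β u δ : ℕ → ℝ} (hβ : Tendsto β atTop (𝓝 0))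
    (hu : Tendsto u atTop (𝓝 0)) (hδ : Tendsto δ atTop (𝓝 0)) :
    Tendsto (fun n => coverageBound α (β n) fbar Ls (u n) (δ n) n) atTop (𝓝 (1 - α)) := by
  have := (hβ.const_sub 1).mul ((((hu.const_mul (2 * fbar * Ls)).const_sub (1 - α)).sub
    (hδ.const_mul 3)).sub (tendsto_one_div_add_atTop_nhds_zero_nat (𝕜 := ℝ)))
  simpa [coverageBound] using this

lemma tendsto_zero_of_isBigO_rpow {e v : ℕ → ℝ} {r : ℝ} (hr : 0 < r)
    (he : Tendsto e atTop (𝓝 0)) (hv : v =O[atTop] fun n => e n ^ r) : Tendsto v atTop (𝓝 0) := by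
  refine hv.trans_tendsto ?_
  simpa [Real.zero_rpow hr.ne'] using he.rpow_const (p := r) (Or.inr hr.le)

end Asymptotics

end DPSCP
theorem mainTheorem4 {𝒵 : Type*} [MeasurableSpace 𝒵] (P : Measure 𝒵) [IsProbabilityMeasure P]
    {d : ℕ}
    -- parameter set, loss, and hyperparameters for each sample size
    (K : Set (E d)) (hKne : K.Nonempty) (hKcl : IsClosed K) (hKcv : Convex ℝ K)
    (loss : E d → 𝒵 → ℝ) (h : ℕ → SGDParams d)
    (hθ₀ : ∀ n, (h n).θ₀ ∈ K) (hη : ∀ n, 0 ≤ (h n).η) (hC : ∀ n, 0 < (h n).C)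
    (hσ : ∀ n, 0 ≤ (h n).σ)
    -- the gradient of the loss exists and is `Lg`-Lipschitz on the parameter set
    (Lg : ℝ) (hLg : 0 < Lg)
    (hdiff : ∀ z, ∀ θ ∈ K, DifferentiableAt ℝ (fun θ' => loss θ' z) θ)
    (hsmooth : ∀ z, ∀ θ ∈ K, ∀ θ' ∈ K,
      ‖gradient (fun w => loss w z) θ - gradient (fun w => loss w z) θ'‖ ≤ Lg * ‖θ - θ'‖)
    (hgmeas : ∀ θ ∈ K, Measurable fun z => gradient (fun w => loss w z) θ)
    -- the score is Lipschitz in the parameter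
    (s : 𝒵 → E d → ℝ) (hsmeas : ∀ θ ∈ K, Measurable fun z => s z θ)
    (Ls : ℝ) (hLs : 0 ≤ Ls)
    (hLip : ∀ z, ∀ θ ∈ K, ∀ θ' ∈ K, |s z θ - s z θ'| ≤ Ls * ‖θ - θ'‖)
    -- regularity of the ideal scores
    (α : ℝ) (hα0 : 0 < α) (hα1 : α < 1)
    (hties : ∀ n, NoTies P K loss s (h n) n)
    (fbar ρ : ℝ) (hρ : 0 < ρ)
    (hanti : ∀ n, AntiConcentrated P K loss s (h n) α n fbar ρ)
    -- training regime
    (hηO : (fun n => (h n).η) =O[atTop] fun n : ℕ => 1 / (n : ℝ))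
    (hTO : (fun n => ((h n).T : ℝ)) =O[atTop] fun n : ℕ => (n : ℝ))
    (hCσO : (fun n => 2 * (h n).C + (h n).σ * √(d : ℝ)) =O[atTop] fun _ : ℕ => (1 : ℝ))
    -- calibration: noise scale, number of steps, failure probability, search range
    (σQ : ℕ → ℝ) (hσQ : ∀ n, 0 < σQ n) (N : ℕ → ℕ)
    (β : ℕ → ℝ) (hβ0 : ∀ n, 0 < β n) (hβ1 : ∀ n, β n < 1)
    (hβO : β =O[atTop] fun n : ℕ => 1 / (n : ℝ))
    (a b : ∀ n : ℕ, (Fin n → ℝ) → ℝ) (ha : ∀ n, Measurable (a n)) (hb : ∀ n, Measurable (b n))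
    (hrange : ∀ n, ∀ᵐ ω ∂(sampleMeasure P d n (h n).q), ∀ i : Fin n,
      actualScore K loss s (h n) i.castSucc ω
        ≤ b n fun j => actualScore K loss s (h n) j.castSucc ω)
    -- stability parameters
    (u δ : ℕ → ℝ) (hu0 : ∀ n, 0 < u n) (hδ0 : ∀ n, 0 < δ n)
    (hu : u =Θ[atTop] fun n => stabilityRate Lg (h n) n ^ (2 / 3 : ℝ))
    (hδ : δ =Θ[atTop] fun n => stabilityRate Lg (h n) n ^ (1 / 3 : ℝ)) :
    -- model stability holds as soon as the constants in `Θ` are such that `E_n ≤ u_n δ_n`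
    (∀ n, stabilityRate Lg (h n) n ≤ u n * δ n → ModelStable P K loss (h n) n (u n) (δ n)) ∧
    -- the buffer is `O(n^{2/3})`
    ((fun n => (buffer fbar Ls (u n) (δ n) n : ℝ)) =O[atTop] fun n : ℕ => (n : ℝ) ^ (2 / 3 : ℝ)) ∧
    -- coverage, for each sample size at which the coverage theorem applies
    (∀ n, ModelStable P K loss (h n) n (u n) (δ n) → Ls * u n ≤ ρ →
      targetRank α n + buffer fbar Ls (u n) (δ n) n ≤ n →
      coverageBound α (β n) fbar Ls (u n) (δ n) n ≤
        (sampleMeasure P d n (h n).q).real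
          {ω | actualScore K loss s (h n) (Fin.last n) ω ≤
            qHat K loss s (h n) (a n) (b n) α (buffer fbar Ls (u n) (δ n) n) (N n) (σQ n) (β n) ω}) ∧
    -- the side conditions hold for all large sample sizes
    (∀ᶠ n in atTop, Ls * u n ≤ ρ ∧ targetRank α n + buffer fbar Ls (u n) (δ n) n ≤ n) ∧
    -- the bound tends to the nominal level
    Tendsto (fun n => coverageBound α (β n) fbar Ls (u n) (δ n) n) atTop (𝓝 (1 - α)) := by
  have he0 : ∀ n, 0 ≤ stabilityRate Lg (h n) n := fun n =>
    stabilityRate_nonneg hLg (hη n) (hC n) (hσ n) n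
  have heO := stabilityRate_isBigO hLg hη hηO hTO hCσO
  have he := heO.trans_tendsto tendsto_inv_atTop_nhds_zero_nat
  have hutendsto := tendsto_zero_of_isBigO_rpow (by norm_num) he hu.isBigO
  have hδtendsto := tendsto_zero_of_isBigO_rpow (by norm_num) he hδ.isBigO
  have hβtendsto := hβO.trans_tendsto tendsto_one_div_atTop_nhds_zero_nat
  have hbuf := buffer_isBigO (fbar := fbar) (Ls := Ls) he0 heO hu hδ
  have hgcont : ∀ z, ContinuousOn (fun θ => gradient (fun w => loss w z) θ) K := fun z =>
    (LipschitzOnWith.of_dist_le_mul (K := Lg.toNNReal) fun θ hθ θ' hθ' => by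
      simpa [dist_eq_norm, hLg.le] using hsmooth z θ hθ θ' hθ').continuousOn
  have hscont : ∀ z, ContinuousOn (s z) K := fun z =>
    (LipschitzOnWith.of_dist_le_mul (K := Ls.toNNReal) fun θ hθ θ' hθ' => by
      simpa [dist_eq_norm, hLs] using hLip z θ hθ θ' hθ').continuousOn
  refine ⟨fun n hE => ?_, hbuf, fun n hstable huρ hrank => ?_, ?_, ?_⟩
  · exact modelStable_of_stabilityRate_le P hKne hKcl hKcv hLg (hη n) (hC n) (hσ n) (hθ₀ n)
      hsmooth (hu0 n) hE
  · exact le_qHat_probability hKne hKcl hKcv (hθ₀ n) hLs hLip hα1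
      (measurable_idealScore hKne hKcl hKcv (hC n) (hθ₀ n) hgcont hgmeas hscont hsmeas)
      (hties n) hρ (hanti n) (hσQ n) (hβ0 n) (hβ1 n) (N n) (a n) (b n) (hrange n) (hu0 n) (hδ0 n)
      hstable huρ hrank
  · refine Eventually.and ?_ (eventually_targetRank_add_le hα0 hα1
      (hbuf.trans_isLittleO (natCast_rpow_isLittleO (by norm_num))))
    have := hutendsto.const_mul Ls
    rw [mul_zero] at this
    exact this.eventually_le_const hρ
  · exact tendsto_coverageBound hβtendsto hutendsto hδtendsto
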